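/- All graphs are finite, simple and undirected. For a graph $H$ and $S\subseteq V(H)$, let $H[S]$ be the subgraph induced by $S$, and let $\partial_H(S)$ be the set of vertices of $S$ that have a neighbor in $V(H)\setminus S$. A graph is a $k$-matching if it is isomorphic to the graph on $2k$ vertices that consists of $k$ vertex-disjoint edges. For $M\subseteq V(H)$, the pair $(H,M)$ is called a $k$-matching gadget if $H[M]$ is a $k$-matching and, with $C:=V(H)\setminus M$, the following holds: whenever $C'\subseteq V(H)$ and $f$ is an isomorphism from $H[C]$ to $H[C']$ such that (1) $H[V(H)\setminus C']$ has no isolated vertex, (2) $H[V(H)\setminus C']$ is bipartite, and (3) $f(\partial_H(C))=\partial_H(C')$, then $H[V(H)\setminus C']$ is a $k$-matching. Theorem. Let $\mathcal H$ be a class of graphs whose vertex-cover numbers are unbounded (for every $b\in\mathbb N$ some $H\in\mathcal H$ has no vertex cover of size at most $b$) and whose treewidths are bounded (there is $w\in\mathbb N$ such that every $H\in\mathcal H$ has treewidth at most $w$). Then for every $k\in\mathbb N$ there exist a graph $H\in\mathcal H$ and a set $M\subseteq V(H)$ such that $(H,M)$ is a $k$-matching gadget. -/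

import Mathlib

universe u

/-- A finite simple graph, bundled with its vertex type. -/
structure FiniteGraph where
  V : Type u
  [finite : Finite V]
  graph : SimpleGraph V

attribute [instance] FiniteGraph.finite

/-- A graph parameter is bounded on a class of graphs if a single natural number bounds it
on all members of the class. -/
def IsBoundedOn (f : FiniteGraph.{u} → ℕ∞) (𝓗 : Set FiniteGraph.{u}) : Prop :=
  ∃ b : ℕ, ∀ H ∈ 𝓗, f H ≤ b

/-- A tree decomposition of a graph: a finite tree together with a bag for each of its nodes. -/
structure TreeDecomposition {V : Type u} (G : SimpleGraph V) where
  Node : Type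
  [finite : Finite Node]
  tree : SimpleGraph Node
  isTree : tree.IsTree
  bag : Node → Set V
  iUnion_bag : ⋃ t, bag t = Set.univ
  edge_mem : ∀ u v : V, G.Adj u v → ∃ t, u ∈ bag t ∧ v ∈ bag t
  connected : ∀ v : V, (tree.induce {t | v ∈ bag t}).Connected

/-- The maximum size of a bag minus one. (For the graph without vertices the truncated subtraction
gives `0` instead of `-1`, which does not affect boundedness on a class.) -/
noncomputable def TreeDecomposition.width {V : Type u} {G : SimpleGraph V}
    (D : TreeDecomposition G) : ℕ∞ :=
  (⨆ t, (D.bag t).encard) - 1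

/-- The minimum width of a tree decomposition. -/
noncomputable def treewidth {V : Type u} (G : SimpleGraph V) : ℕ∞ :=
  ⨅ D : TreeDecomposition G, D.width

/-- The graph on `2k` vertices that consists of `k` vertex-disjoint edges. -/
def disjointEdges (k : ℕ) : SimpleGraph (Fin k × Bool) where
  Adj x y := x.1 = y.1 ∧ x.2 ≠ y.2
  symm := ⟨fun _ _ h => ⟨h.1.symm, h.2.symm⟩⟩
  loopless := ⟨fun _ h => h.2 rfl⟩

/-- `G` is a `k`-matching: it is isomorphic to `k` vertex-disjoint edges. -/
def IsKMatching {V : Type u} (G : SimpleGraph V) (k : ℕ) : Prop :=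
  Nonempty (G ≃g disjointEdges k)

/-- The set of vertices of `C` that have a neighbor outside `C`. -/
def vertexBoundary {V : Type u} (H : SimpleGraph V) (C : Set V) : Set V :=
  {v | v ∈ C ∧ ∃ w, w ∉ C ∧ H.Adj v w}

/-- The isomorphism `f` from `H[C]` to `H[C']` maps the boundary of `C` onto that of `C'`. -/
def IsBoundaryPreserving {V : Type u} (H : SimpleGraph V) {C C' : Set V}
    (f : H.induce C ≃g H.induce C') : Prop :=
  (fun x : C => (f x : V)) '' {x : C | (x : V) ∈ vertexBoundary H C} = vertexBoundary H C'

/-- `(H, M)` is a `k`-matching gadget. The induced matching is given by its vertex set `M`,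
so that `C = Mᶜ`. -/
def IsMatchingGadget {V : Type u} (H : SimpleGraph V) (k : ℕ) (M : Set V) : Prop :=
  IsKMatching (H.induce M) k ∧
    ∀ (C' : Set V) (f : H.induce Mᶜ ≃g H.induce C'),
      (∀ v, ¬ (H.induce C'ᶜ).IsIsolated v) →
      (H.induce C'ᶜ).IsBipartite →
      IsBoundaryPreserving H f →
      IsKMatching (H.induce C'ᶜ) k

/-! Call a set `S` protected for `M` if every boundary preserving isomorphism from `H - M` to some
`H - D` maps `S` into itself. The criterion for a gadget (`isMatchingGadget_of_isScattered`) is an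
edge count. Let `M` consist of k edges whose closed neighborhoods in `H - S` are disjoint, each edge
lying in at most t triangles of `H - S`, and let the edges in fewer than t triangles have a cover
that avoids the closed neighborhood of `M`. These low edges then survive the deletion and their
images exhaust all low edges, so none has an endpoint in `D`. Every edge inside `D` therefore lies
in at least t triangles. As `D` is bipartite without isolated vertices, at least as many edges leave
`D` towards `H - S` as leave `M`; the edges towards `S` agree because `S` is preserved. Comparing
total edge counts, `D` spans at most k edges, hence is a perfect matching.

Such an `M` is found by induction on t (`exists_gadgetBound`). Bounded treewidth enters only through
`HasSmallTops`. Let n be the cover number of the edges in fewer than t+1 triangles. A hub is a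
vertex near which a positive proportion of n is needed for a cover; only boundedly many exist
(`card_hubs_lt`). If no hub size falls in a suitable gap, deleting an `M` that touches little of the
cover cannot change which vertices are hubs, so the hubs may be added to `S`. Protection is needed
only for `M` with a light neighborhood, and a weight function records this requirement over all
rounds. By `exists_scale`, the gap can be placed so that half of a large matching is not near any
hub of intermediate size.

With the hubs in `S`, two cases remain. If the edges in fewer than t triangles still have large
cover number, the induction hypothesis applies. Otherwise every remaining vertex is near few
matching edges, so many of these have disjoint neighborhoods (`exists_pairwiseDisjoint`), and k of
them that avoid the small cover and are light satisfy the criterion. The induction can be started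
because edges in at most 3b triangles carry half of the vertex cover number (`exists_covers_adj`).
-/

/-! ### Trees and tree decompositions -/

/-- A tree can be rooted: every edge joins a node to its parent, which is one level higher. -/
theorem SimpleGraph.IsTree.exists_depth_parent {N : Type*} {T : SimpleGraph N} (hT : T.IsTree) :
    ∃ (d : N → ℕ) (par : N → N), ∀ u v, T.Adj u v →
      (d v = d u + 1 ∧ par v = u) ∨ (d u = d v + 1 ∧ par u = v) := by
  classical
  obtain ⟨r⟩ := hT.connected.nonempty
  have key : ∀ u u' v, T.Adj u v → T.Adj u' v → T.dist r v = T.dist r u + 1 →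
      T.dist r v = T.dist r u' + 1 → u = u' := by
    intro u u' v h h' hd hd'
    obtain ⟨p, hp, hpl⟩ := (hT.connected r u).exists_path_of_dist
    obtain ⟨q, hq, hql⟩ := (hT.connected r u').exists_path_of_dist
    have h1 : (p.concat h).IsPath := SimpleGraph.Walk.isPath_of_length_eq_dist _ (by simp; omega)
    have h2 : (q.concat h').IsPath := SimpleGraph.Walk.isPath_of_length_eq_dist _ (by simp; omega)
    have h3 := congrArg (fun w : T.Path r v => w.1.penultimate)
      ((hT.isAcyclic.subsingleton_path r v).elim ⟨_, h1⟩ ⟨_, h2⟩)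
    simpa using h3
  refine ⟨T.dist r, fun v => if h : ∃ u, T.Adj u v ∧ T.dist r v = T.dist r u + 1 then h.choose
    else v, fun u v huv => ?_⟩
  have aux : ∀ u v, T.Adj u v → T.dist r v = T.dist r u + 1 →
      (if h : ∃ u, T.Adj u v ∧ T.dist r v = T.dist r u + 1 then h.choose else v) = u := by
    intro u v huv hd
    have h : ∃ u, T.Adj u v ∧ T.dist r v = T.dist r u + 1 := ⟨u, huv, hd⟩
    rw [dif_pos h]
    exact key _ _ _ h.choose_spec.1 huv h.choose_spec.2 hd
  rcases hT.dist_eq_dist_add_one_of_adj r huv with h | h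
  · exact Or.inr ⟨h, aux v u huv.symm h⟩
  · exact Or.inl ⟨h, aux u v huv h⟩

section Rooted

variable {N : Type*} {T : SimpleGraph N} {d : N → ℕ} {par : N → N}

/-- In a rooted tree, a connected set contains the parent of every member that is not its top. -/
theorem parent_mem_of_preconnected
    (hpar : ∀ u v, T.Adj u v → (d v = d u + 1 ∧ par v = u) ∨ (d u = d v + 1 ∧ par u = v))
    {I : Set N} (hI : (T.induce I).Preconnected) {x y : N}
    (hx : x ∈ I) (hy : y ∈ I) (hne : y ≠ x) (hd : d y ≤ d x) : par x ∈ I ∧ d (par x) + 1 = d x := by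
  by_contra hcon
  -- A walk in `I` that starts at `x` cannot step up from `x`, so it stays among the descendants of
  -- `x`.
  have key : ∀ (u v : I), (T.induce I).Walk u v →
      (∃ j, d u = d x + j ∧ par^[j] u = x) → ∃ j, d v = d x + j ∧ par^[j] v = x := by
    intro u v p
    induction p with
    | nil => exact id
    | @cons u v w huv _ ih =>
      rintro ⟨j, hj, hj'⟩
      apply ih
      have huv' : T.Adj u v := huv
      rcases hpar _ _ huv' with ⟨h1, h2⟩ | ⟨h1, h2⟩
      · exact ⟨j + 1, by omega, by rw [Function.iterate_succ_apply, h2, hj']⟩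
      · cases j with
        | zero =>
          simp only [Function.iterate_zero, id] at hj'
          rw [hj'] at h1 h2
          exact absurd ⟨h2 ▸ v.2, by rw [h2]; omega⟩ hcon
        | succ j => exact ⟨j, by omega, by rw [← h2, ← Function.iterate_succ_apply, hj']⟩
  obtain ⟨p⟩ := hI ⟨x, hx⟩ ⟨y, hy⟩
  obtain ⟨j, hj, hjx⟩ := key _ _ p ⟨0, rfl, rfl⟩
  have hj0 : j = 0 := by simp only at hj; omega
  subst hj0
  exact hne hjx

/-- If two connected sets meet, the one with the deeper top has its top in the other one. -/
theorem top_mem_of_preconnected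
    (hpar : ∀ u v, T.Adj u v → (d v = d u + 1 ∧ par v = u) ∨ (d u = d v + 1 ∧ par u = v))
    {I J : Set N} (hI : (T.induce I).Preconnected)
    (hJ : (T.induce J).Preconnected) {x y z : N} (hx : x ∈ I) (hxmin : ∀ v ∈ I, d x ≤ d v)
    (hy : y ∈ J) (hzI : z ∈ I) (hzJ : z ∈ J) (hd : d y ≤ d x) : x ∈ J := by
  -- Induction on the depth of the common node `z` below `x`: while `z` is deeper than both tops,
  -- its parent is again common.
  obtain ⟨n, hn⟩ := Nat.exists_eq_add_of_le (hxmin z hzI)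
  induction n generalizing z with
  | zero =>
    by_cases hzx : z = x
    · exact hzx ▸ hzJ
    · obtain ⟨h1, h2⟩ := parent_mem_of_preconnected hpar hI hzI hx (Ne.symm hzx) (by omega)
      have := hxmin _ h1
      omega
  | succ n ih =>
    obtain ⟨h1, h2⟩ := parent_mem_of_preconnected hpar hI hzI hx
      (by rintro rfl; omega) (by omega)
    obtain ⟨h3, -⟩ := parent_mem_of_preconnected hpar hJ hzJ hy
      (by rintro rfl; omega) (by omega)
    exact ih h1 h3 (by omega)

end Rooted

/-- The consequence of bounded treewidth that is used: to every connected vertex set `K` one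
can attach at most `b` vertices, and a level, such that whenever two connected sets meet or are
adjacent, the vertices attached to the one of higher level meet the other one. -/
def HasSmallTops {V : Type u} (H : SimpleGraph V) (b : ℕ) : Prop :=
  ∃ (lev : Set V → ℕ) (top : Set V → Finset V), (∀ K, (top K).card ≤ b) ∧
    ∀ K L, (H.induce K).Connected → (H.induce L).Connected →
      (∃ x ∈ K, ∃ y ∈ L, x = y ∨ H.Adj x y) → lev L ≤ lev K → ∃ v ∈ top K, v ∈ L

/-- The subtrees of adjacent vertices share a node, so a walk in `K` links the subtrees of its
vertices. -/
theorem TreeDecomposition.preconnected_nodes {V : Type u} {H : SimpleGraph V}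
    (D : TreeDecomposition H) {K : Set V} (hK : (H.induce K).Preconnected) :
    (D.tree.induce {t | ∃ v ∈ K, v ∈ D.bag t}).Preconnected := by
  have single : ∀ v ∈ K, ∀ s t : {t | ∃ v ∈ K, v ∈ D.bag t}, v ∈ D.bag s → v ∈ D.bag t →
      (D.tree.induce {t | ∃ v ∈ K, v ∈ D.bag t}).Reachable s t := by
    intro v hv s t hs ht
    have h := (D.connected v).preconnected ⟨s, hs⟩ ⟨t, ht⟩
    have hsub : {t | v ∈ D.bag t} ⊆ {t | ∃ v ∈ K, v ∈ D.bag t} := fun t ht => ⟨v, hv, ht⟩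
    exact h.map (SimpleGraph.induceHomOfLE D.tree hsub).toHom
  have walk : ∀ u v : K, (H.induce K).Walk u v → ∀ s t : {t | ∃ v ∈ K, v ∈ D.bag t},
      (u : V) ∈ D.bag s → (v : V) ∈ D.bag t →
      (D.tree.induce {t | ∃ v ∈ K, v ∈ D.bag t}).Reachable s t := by
    intro u v p
    induction p with
    | nil => intro s t hs ht; exact single _ (Subtype.property _) s t hs ht
    | @cons u v w huv _ ih =>
      intro s t hs ht
      obtain ⟨r, hr, hr'⟩ := D.edge_mem u v huv
      exact (single u u.2 s ⟨r, u, u.2, hr⟩ hs hr).trans (ih ⟨r, u, u.2, hr⟩ t hr' ht)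
  rintro ⟨s, u, hu, hus⟩ ⟨t, v, hv, hvt⟩
  obtain ⟨p⟩ := hK ⟨u, hu⟩ ⟨v, hv⟩
  exact walk _ _ p _ _ hus hvt

theorem TreeDecomposition.hasSmallTops {V : Type u} [Finite V] {H : SimpleGraph V}
    (D : TreeDecomposition H) {b : ℕ} (hb : ∀ t, (D.bag t).ncard ≤ b) : HasSmallTops H b := by
  classical
  have := D.finite
  obtain ⟨d, par, hpar⟩ := D.isTree.exists_depth_parent
  let I : Set V → Set D.Node := fun K => {t | ∃ v ∈ K, v ∈ D.bag t}
  obtain ⟨r⟩ := D.isTree.connected.nonempty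
  have hmin : ∀ K : Set V, ∃ x, (I K).Nonempty → x ∈ I K ∧ ∀ y ∈ I K, d x ≤ d y := by
    intro K
    by_cases h : (I K).Nonempty
    · obtain ⟨x, hx, hx'⟩ := Set.exists_min_image (I K) d (Set.toFinite _) h
      exact ⟨x, fun _ => ⟨hx, hx'⟩⟩
    · exact ⟨r, fun h' => absurd h' h⟩
  choose node hnode using hmin
  have hne : ∀ v, ∃ t, v ∈ D.bag t := fun v => by
    obtain ⟨t⟩ := (D.connected v).nonempty
    exact ⟨t, t.2⟩
  -- The level is the depth of the topmost node whose bag meets `K`, and the attached vertices are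
  -- the bag of that node.
  refine ⟨fun K => d (node K), fun K => (Set.toFinite (D.bag (node K))).toFinset, fun K => ?_, ?_⟩
  · rw [← Set.ncard_eq_toFinset_card]
    exact hb _
  · rintro K L hK hL ⟨x, hx, y, hy, hxy⟩ hlev
    have hz : ∃ z, z ∈ I K ∧ z ∈ I L := by
      rcases hxy with rfl | hxy
      · obtain ⟨t, ht⟩ := hne x
        exact ⟨t, ⟨x, hx, ht⟩, ⟨x, hy, ht⟩⟩
      · obtain ⟨t, ht, ht'⟩ := D.edge_mem x y hxy
        exact ⟨t, ⟨x, hx, ht⟩, ⟨y, hy, ht'⟩⟩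
    obtain ⟨z, hzK, hzL⟩ := hz
    obtain ⟨h1, h2⟩ := hnode K ⟨z, hzK⟩
    obtain ⟨h3, -⟩ := hnode L ⟨z, hzL⟩
    obtain ⟨v, hv, hv'⟩ := top_mem_of_preconnected hpar (D.preconnected_nodes hK.preconnected)
      (D.preconnected_nodes hL.preconnected) h1 h2 h3 hzK hzL hlev
    exact ⟨v, by simpa using hv', hv⟩

theorem hasSmallTops_of_treewidth_le {V : Type u} [Finite V] {H : SimpleGraph V} {w : ℕ}
    (h : treewidth H ≤ w) : HasSmallTops H (w + 1) := by
  have hex : ∃ D : TreeDecomposition H, D.width ≤ w := by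
    by_contra! hcon
    have : ((w + 1 : ℕ) : ℕ∞) ≤ treewidth H :=
      le_iInf fun D => by
        have := Order.add_one_le_of_lt (hcon D)
        exact_mod_cast this
    have := this.trans h
    norm_cast at this
    omega
  obtain ⟨D, hD⟩ := hex
  refine D.hasSmallTops fun t => ?_
  have h1 : (D.bag t).encard ≤ (⨆ t, (D.bag t).encard) := le_iSup (fun t => (D.bag t).encard) t
  have h2 : (D.bag t).encard ≤ w + 1 := h1.trans (tsub_le_iff_right.mp hD)
  rw [← (Set.toFinite (D.bag t)).cast_ncard_eq] at h2
  exact_mod_cast h2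

/-! ### Isomorphisms between complements of small sets -/

section Swap

variable {V : Type u} {H : SimpleGraph V}

/-- `φ` restricts to a boundary preserving isomorphism from `H - M` to `H - D`. -/
structure IsSwap (H : SimpleGraph V) (M D : Finset V) (φ : V → V) : Prop where
  maps : ∀ x ∉ M, φ x ∉ D
  inj : ∀ x ∉ M, ∀ y ∉ M, φ x = φ y → x = y
  surj : ∀ y ∉ D, ∃ x ∉ M, φ x = y
  adj : ∀ x ∉ M, ∀ y ∉ M, H.Adj (φ x) (φ y) ↔ H.Adj x y
  bdry : ∀ x ∉ M, (∃ m ∈ M, H.Adj x m) ↔ ∃ w ∈ D, H.Adj (φ x) w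

/-- Every boundary preserving isomorphism defined on `H - M` maps `S` into itself. -/
def IsProtected (H : SimpleGraph V) (S M : Finset V) : Prop :=
  ∀ D φ, IsSwap H M D φ → ∀ x ∈ S, φ x ∈ S

/-- `Y` contains an endpoint of every edge of `F`. -/
def Covers (Y : Finset V) (F : V → V → Prop) : Prop :=
  ∀ u v, F u v → u ∈ Y ∨ v ∈ Y

/-- By finiteness, an injection of `S` into itself is onto, so no vertex outside `S` can also land
in `S`. -/
theorem IsSwap.mem_iff {S M D : Finset V} {φ : V → V} (hφ : IsSwap H M D φ) (hMS : Disjoint M S)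
    (hS : ∀ x ∈ S, φ x ∈ S) {x : V} (hx : x ∉ M) : φ x ∈ S ↔ x ∈ S := by
  classical
  refine ⟨fun h => ?_, hS x⟩
  have hSM : ∀ s ∈ S, s ∉ M := fun s hs hm => Finset.disjoint_left.mp hMS hm hs
  have hinj : Set.InjOn φ S := fun a ha b hb => hφ.inj a (hSM a ha) b (hSM b hb)
  obtain ⟨s, hs, hsx⟩ := Finset.surjOn_of_injOn_of_card_le φ hS hinj le_rfl h
  exact hφ.inj s (hSM s hs) x hx hsx ▸ hs

variable [Fintype V]

open scoped Classical in
/-- The closed neighborhood of `M` in `H - S`. -/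
noncomputable def closedNbhd (H : SimpleGraph V) (S M : Finset V) : Finset V :=
  Finset.univ.filter fun v => v ∉ S ∧ (v ∈ M ∨ ∃ m ∈ M, H.Adj m v)

open scoped Classical in
/-- The number of common neighbors in `H - S`. -/
noncomputable def codegree (H : SimpleGraph V) (S : Finset V) (u v : V) : ℕ :=
  (Finset.univ.filter fun x => x ∉ S ∧ H.Adj x u ∧ H.Adj x v).card

/-- The edges of `H - S` that lie in fewer than `t` triangles of `H - S`. -/
def LowEdge (H : SimpleGraph V) (S : Finset V) (t : ℕ) (u v : V) : Prop :=
  u ∉ S ∧ v ∉ S ∧ H.Adj u v ∧ codegree H S u v < t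

theorem mem_closedNbhd {S M : Finset V} {v : V} :
    v ∈ closedNbhd H S M ↔ v ∉ S ∧ (v ∈ M ∨ ∃ m ∈ M, H.Adj m v) := by
  simp [closedNbhd]

theorem codegree_comm (S : Finset V) (u v : V) : codegree H S u v = codegree H S v u := by
  unfold codegree
  congr 1
  ext x
  simp only [Finset.mem_filter]
  tauto

theorem LowEdge.symm {S : Finset V} {t : ℕ} {u v : V} (h : LowEdge H S t u v) :
    LowEdge H S t v u :=
  ⟨h.2.1, h.1, h.2.2.1.symm, codegree_comm (H := H) S u v ▸ h.2.2.2⟩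

/-- An edge in few triangles is mapped to such an edge unless both its endpoints are adjacent
to the deleted set. -/
theorem IsSwap.lowEdge {S M D : Finset V} {φ : V → V} (hφ : IsSwap H M D φ) (hMS : Disjoint M S)
    (hS : ∀ x ∈ S, φ x ∈ S) {t : ℕ} {u v : V} (hu : u ∉ M) (hv : v ∉ M) (huv : LowEdge H S t u v)
    (hnot : ¬ (u ∈ closedNbhd H S M ∧ v ∈ closedNbhd H S M)) : LowEdge H S t (φ u) (φ v) := by
  classical
  wlog h : u ∉ closedNbhd H S M generalizing u v
  · exact (this hv hu huv.symm (fun h => hnot ⟨h.2, h.1⟩)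
      (fun hv' => hnot ⟨not_not.mp h, hv'⟩)).symm
  obtain ⟨huS, hvS, hadj, hcod⟩ := huv
  refine ⟨fun h => huS ((hφ.mem_iff hMS hS hu).mp h), fun h => hvS ((hφ.mem_iff hMS hS hv).mp h),
    (hφ.adj u hu v hv).mpr hadj, lt_of_le_of_lt ?_ hcod⟩
  -- Since `u` is off the boundary, so is `φ u`; hence every triangle at the image edge is the image
  -- of a triangle.
  have hbd : ¬ ∃ w ∈ D, H.Adj (φ u) w := by
    rw [← hφ.bdry u hu]
    rintro ⟨m, hm, hum⟩
    exact h (mem_closedNbhd.mpr ⟨huS, Or.inr ⟨m, hm, hum.symm⟩⟩)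
  refine Finset.card_le_card_of_surjOn φ ?_
  intro x hx
  simp only [Finset.coe_filter, Finset.mem_univ, true_and, Set.mem_ofPred_eq] at hx
  obtain ⟨hxS, hxu, hxv⟩ := hx
  obtain ⟨y, hy, rfl⟩ := hφ.surj x (fun hxD => hbd ⟨x, hxD, hxu.symm⟩)
  refine ⟨y, ?_, rfl⟩
  simp only [Finset.coe_filter, Finset.mem_univ, true_and, Set.mem_ofPred_eq]
  exact ⟨fun h => hxS (hS y h), (hφ.adj y hy u hu).mp hxu, (hφ.adj y hy v hv).mp hxv⟩

/-- If a cover of the edges in fewer than `t` triangles avoids the closed neighborhood of `M`,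
then these edges survive, so no such edge has an endpoint in `D`. -/
theorem IsSwap.not_lowEdge {S M D Y : Finset V} {φ : V → V} (hφ : IsSwap H M D φ)
    (hMS : Disjoint M S) (hS : ∀ x ∈ S, φ x ∈ S) {t : ℕ} (hY : Covers Y (LowEdge H S t))
    (hYM : Disjoint Y (closedNbhd H S M)) {u v : V} (hu : u ∈ D) : ¬ LowEdge H S t u v := by
  classical
  intro huv
  have hnot : ∀ u v, LowEdge H S t u v →
      ¬ (u ∈ closedNbhd H S M ∧ v ∈ closedNbhd H S M) := by
    rintro u v h ⟨h1, h2⟩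
    rcases hY u v h with h3 | h3
    · exact Finset.disjoint_left.mp hYM h3 h1
    · exact Finset.disjoint_left.mp hYM h3 h2
  have hM : ∀ u v, LowEdge H S t u v → u ∉ M := by
    intro u v h hu
    exact hnot u v h ⟨mem_closedNbhd.mpr ⟨h.1, Or.inl hu⟩,
      mem_closedNbhd.mpr ⟨h.2.1, Or.inr ⟨u, hu, h.2.2.1⟩⟩⟩
  -- `φ` injects the finite set `P` into itself, so it is onto: endpoints of low edges are images,
  -- hence outside `D`.
  let P : Finset (V × V) := Finset.univ.filter fun p => LowEdge H S t p.1 p.2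
  have hP : ∀ p, p ∈ P ↔ LowEdge H S t p.1 p.2 := by simp [P]
  obtain ⟨p, hp, hpe⟩ := Finset.surjOn_of_injOn_of_card_le (s := P) (t := P) (Prod.map φ φ)
    (by
      intro p hp
      have h := (hP p).mp hp
      exact (hP _).mpr (hφ.lowEdge hMS hS (hM _ _ h) (hM _ _ h.symm) h (hnot _ _ h)))
    (by
      intro p hp q hq hpq
      have h := (hP p).mp hp
      have h' := (hP q).mp hq
      simp only [Prod.map, Prod.mk.injEq] at hpq
      exact Prod.ext (hφ.inj _ (hM _ _ h) _ (hM _ _ h') hpq.1)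
        (hφ.inj _ (hM _ _ h.symm) _ (hM _ _ h'.symm) hpq.2)) le_rfl
    (a := (u, v)) ((hP _).mpr huv)
  have h := (hP p).mp hp
  apply hφ.maps p.1 (hM _ _ h)
  have : φ p.1 = u := congrArg Prod.fst hpe
  rwa [this]

/-- The edges of `F` with an endpoint in the closed neighborhood of `z`. -/
def NearEdge (H : SimpleGraph V) (F : V → V → Prop) (z u v : V) : Prop :=
  F u v ∧ ((u = z ∨ H.Adj z u) ∨ (v = z ∨ H.Adj z v))

open scoped Classical in
/-- The vertices outside `S` such that every cover of the nearby edges of `F` has size at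
least `h`. -/
noncomputable def hubs (H : SimpleGraph V) (S : Finset V) (F : V → V → Prop) (h : ℝ) : Finset V :=
  Finset.univ.filter fun z => z ∉ S ∧ ∀ Y : Finset V, Covers Y (NearEdge H F z) → h ≤ (Y.card : ℝ)

theorem mem_hubs {S : Finset V} {F : V → V → Prop} {h : ℝ} {z : V} :
    z ∈ hubs H S F h ↔ z ∉ S ∧ ∀ Y : Finset V, Covers Y (NearEdge H F z) → h ≤ (Y.card : ℝ) := by
  simp [hubs]

theorem hubs_anti {S : Finset V} {F : V → V → Prop} {h h' : ℝ} (hh : h ≤ h') :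
    hubs H S F h' ⊆ hubs H S F h := fun _ hz =>
  mem_hubs.mpr ⟨(mem_hubs.mp hz).1, fun Y hY => hh.trans ((mem_hubs.mp hz).2 Y hY)⟩

open scoped Classical in
/-- Hubs can be added to a protected set if there is a gap in their sizes. -/
theorem IsProtected.union_hubs {S M Y₀ : Finset V} {t : ℕ} {h c : ℝ} (hS : IsProtected H S M)
    (hM : Disjoint M (S ∪ hubs H S (LowEdge H S t) h)) (hY₀ : Covers Y₀ (LowEdge H S t))
    (hgap : hubs H S (LowEdge H S t) (h - c) ⊆ hubs H S (LowEdge H S t) h)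
    (hc : ((Y₀ ∩ closedNbhd H S M).card : ℝ) ≤ c) :
    IsProtected H (S ∪ hubs H S (LowEdge H S t) h) M := by
  intro D φ hφ z hz
  have hMS : Disjoint M S := hM.mono_right Finset.subset_union_left
  have hφS := hS D φ hφ
  rcases Finset.mem_union.mp hz with hz | hz
  · exact Finset.mem_union_left _ (hφS z hz)
  have hzM : z ∉ M := fun h' => Finset.disjoint_left.mp hM h' (Finset.mem_union_right _ hz)
  obtain ⟨hzS, hzc⟩ := mem_hubs.mp hz
  refine Finset.mem_union_right _ (hgap (mem_hubs.mpr
    ⟨fun h' => hzS ((hφ.mem_iff hMS hφS hzM).mp h'), fun Y hY => ?_⟩))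
  let Y₁ : Finset V := Finset.univ.filter fun x => x ∉ M ∧ φ x ∈ Y
  have hY₁ : Y₁.card ≤ Y.card := by
    refine Finset.card_le_card_of_injOn φ (fun x hx => ?_) fun x hx y hy => ?_
    · exact (Finset.mem_filter.mp hx).2.2
    · exact hφ.inj x (Finset.mem_filter.mp hx).2.1 y (Finset.mem_filter.mp hy).2.1
  -- Low edges inside the closed neighborhood of `M` are hit by `Y₀`; all others map to low edges,
  -- and those near `z` go near `φ z`. So `φ z` loses at most `c` in hub size, and the gap makes it
  -- a hub again.
  have hcov : Covers (Y₁ ∪ (Y₀ ∩ closedNbhd H S M)) (NearEdge H (LowEdge H S t) z) := by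
    rintro u v ⟨huv, hnear⟩
    by_cases hboth : u ∈ closedNbhd H S M ∧ v ∈ closedNbhd H S M
    · rcases hY₀ u v huv with h' | h'
      · exact Or.inl (Finset.mem_union_right _ (Finset.mem_inter.mpr ⟨h', hboth.1⟩))
      · exact Or.inr (Finset.mem_union_right _ (Finset.mem_inter.mpr ⟨h', hboth.2⟩))
    · have huM : u ∉ M := fun hu => hboth ⟨mem_closedNbhd.mpr ⟨huv.1, Or.inl hu⟩,
        mem_closedNbhd.mpr ⟨huv.2.1, Or.inr ⟨u, hu, huv.2.2.1⟩⟩⟩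
      have hvM : v ∉ M := fun hv => hboth
        ⟨mem_closedNbhd.mpr ⟨huv.1, Or.inr ⟨v, hv, huv.2.2.1.symm⟩⟩,
        mem_closedNbhd.mpr ⟨huv.2.1, Or.inl hv⟩⟩
      have himg := hφ.lowEdge hMS hφS huM hvM huv hboth
      have hn : ∀ x ∉ M, (x = z ∨ H.Adj z x) → (φ x = φ z ∨ H.Adj (φ z) (φ x)) := by
        rintro x hx (rfl | h')
        · exact Or.inl rfl
        · exact Or.inr ((hφ.adj z hzM x hx).mpr h')
      rcases hY _ _ ⟨himg, hnear.imp (hn u huM) (hn v hvM)⟩ with h' | h'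
      · exact Or.inl (Finset.mem_union_left _ (Finset.mem_filter.mpr ⟨Finset.mem_univ _, huM, h'⟩))
      · exact Or.inr (Finset.mem_union_left _ (Finset.mem_filter.mpr ⟨Finset.mem_univ _, hvM, h'⟩))
  have h1 := hzc _ hcov
  have h2 : ((Y₁ ∪ (Y₀ ∩ closedNbhd H S M)).card : ℝ) ≤ Y₁.card + (Y₀ ∩ closedNbhd H S M).card := by
    exact_mod_cast Finset.card_union_le _ _
  have h3 : (Y₁.card : ℝ) ≤ Y.card := by exact_mod_cast hY₁
  linarith

end Swap

/-! ### The gadget criterion -/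

theorem isKMatching_of_bijective {W : Type u} {G : SimpleGraph W} {k : ℕ} (g : Fin k × Bool → W)
    (hg : Function.Bijective g) (hadj : ∀ x y, G.Adj (g x) (g y) ↔ (x.1 = y.1 ∧ x.2 ≠ y.2)) :
    IsKMatching G k :=
  ⟨(⟨Equiv.ofBijective g hg, fun {x y} => hadj x y⟩ : disjointEdges k ≃g G).symm⟩

/-- The partner map exchanges the two color classes, so the vertices of color 0 index the edges. -/
theorem isKMatching_of_existsUnique_adj {W : Type u} [Fintype W] {G : SimpleGraph W} {k : ℕ}
    (hG : ∀ v, ∃! w, G.Adj v w) (hbip : G.IsBipartite) (hcard : Fintype.card W = 2 * k) :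
    IsKMatching G k := by
  classical
  obtain ⟨χ⟩ := hbip
  choose p hp hpu using hG
  have hpp : ∀ v, p (p v) = v := fun v => (hpu (p v) v (hp v).symm).symm
  have hχ : ∀ v, χ (p v) ≠ χ v := fun v h => χ.valid (hp v) h.symm
  have hne : ∀ v, χ v ≠ 0 → χ (p v) = 0 := fun v h => by have := hχ v; omega
  have hcl : (Finset.univ.filter fun v => χ v ≠ 0).card =
      (Finset.univ.filter fun v => χ v = 0).card := by
    refine Finset.card_bij' (fun v _ => p v) (fun v _ => p v) ?_ ?_ ?_ ?_
    · intro v hv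
      simpa using hne v (by simpa using hv)
    · intro v hv
      have h0 : χ v = 0 := by simpa using hv
      have := hχ v
      simpa [h0] using this
    · intro v _; exact hpp v
    · intro v _; exact hpp v
  have hsum := Finset.card_filter_add_card_filter_not (s := (Finset.univ : Finset W))
    (fun v => χ v = 0)
  have hk : Fintype.card {v // χ v = 0} = k := by
    rw [Fintype.card_subtype]
    rw [Finset.card_univ, hcard] at hsum
    simp only [ne_eq] at hcl
    omega
  let e : Fin k ≃ {v // χ v = 0} := (Fintype.equivFinOfCardEq hk).symm
  refine isKMatching_of_bijective (fun x => if x.2 then p (e x.1) else e x.1) ⟨?_, ?_⟩ ?_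
  · rintro ⟨i, s⟩ ⟨j, s'⟩ h
    have hi := (e i).2
    have hj := (e j).2
    have hi' := hχ (e i)
    have hj' := hχ (e j)
    cases s <;> cases s' <;> simp only [if_true, if_false, Bool.false_eq_true] at h
    · simpa [Subtype.ext_iff.symm] using h
    · rw [← h] at hj'; omega
    · rw [h] at hi'; omega
    · have := congrArg p h
      rw [hpp, hpp] at this
      simpa [Subtype.ext_iff.symm] using this
  · intro v
    by_cases hv : χ v = 0
    · exact ⟨(e.symm ⟨v, hv⟩, false), by simp⟩
    · exact ⟨(e.symm ⟨p v, hne v hv⟩, true), by simp [hpp]⟩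
  · have h0 : ∀ v, χ v = 0 → ∀ w, χ w = 0 → ¬ G.Adj v w := fun v hv w hw h =>
      χ.valid h (hv.trans hw.symm)
    have h1 : ∀ i j, G.Adj (e i : W) (p (e j)) ↔ i = j := by
      intro i j
      constructor
      · intro h
        have := hpu (p (e j)) _ h.symm
        rw [hpp] at this
        exact e.injective (Subtype.ext this)
      · rintro rfl; exact hp _
    have h2 : ∀ i j, ¬ G.Adj (p (e i)) (p (e j)) := by
      intro i j h
      have := χ.valid h
      have := hχ (e i)
      have := hχ (e j)
      have := (e i).2
      have := (e j).2
      omega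
    rintro ⟨i, s⟩ ⟨j, s'⟩
    cases s <;> cases s' <;> simp only [if_true, if_false, Bool.false_eq_true]
    · simpa using h0 _ (e i).2 _ (e j).2
    · simpa using h1 i j
    · rw [G.adj_comm]; simpa [eq_comm] using h1 j i
    · simpa using h2 i j

/-! ### Counting adjacent pairs under a swap -/

section Count

variable {V : Type u} {H : SimpleGraph V}

open scoped Classical in
/-- The number of adjacent pairs in `A × B`. -/
noncomputable def adjPairs (H : SimpleGraph V) (A B : Finset V) : ℕ :=
  ∑ x ∈ A, (B.filter fun y => H.Adj x y).card

theorem adjPairs_eq (A B : Finset V) [DecidableRel H.Adj] :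
    adjPairs H A B = ∑ x ∈ A, ∑ y ∈ B, if H.Adj x y then 1 else 0 := by
  unfold adjPairs
  refine Finset.sum_congr rfl fun x _ => ?_
  rw [Finset.card_filter]
  refine Finset.sum_congr rfl fun y _ => ?_
  congr

theorem adjPairs_comm (A B : Finset V) : adjPairs H A B = adjPairs H B A := by
  classical
  rw [adjPairs_eq, adjPairs_eq, Finset.sum_comm]
  simp only [H.adj_comm]

open scoped Classical in
theorem adjPairs_add_sdiff_left {A S : Finset V} (h : S ⊆ A) (B : Finset V) :
    adjPairs H S B + adjPairs H (A \ S) B = adjPairs H A B := by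
  unfold adjPairs
  rw [add_comm, Finset.sum_sdiff h]

open scoped Classical in
/-- Counting adjacent pairs is compatible with a swap. -/
theorem IsSwap.adjPairs_eq {M D A A' B B' : Finset V} {φ : V → V} (hφ : IsSwap H M D φ)
    (hA : Disjoint M A) (hB : Disjoint M B) (hAA : A.image φ = A') (hBB : B.image φ = B') :
    adjPairs H A B = adjPairs H A' B' := by
  have hinj : ∀ A : Finset V, Disjoint M A → Set.InjOn φ A := fun A hA a ha b hb =>
    hφ.inj a (fun h => Finset.disjoint_left.mp hA h ha) b (fun h => Finset.disjoint_left.mp hA h hb)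
  rw [_root_.adjPairs_eq, _root_.adjPairs_eq, ← hAA, ← hBB, Finset.sum_image (hinj A hA)]
  refine Finset.sum_congr rfl fun x hx => ?_
  rw [Finset.sum_image (hinj B hB)]
  refine Finset.sum_congr rfl fun y hy => ?_
  rw [hφ.adj x (fun h => Finset.disjoint_left.mp hA h hx) y
    (fun h => Finset.disjoint_left.mp hB h hy)]

variable [Fintype V]

open scoped Classical in
theorem adjPairs_add_compl_right (A B : Finset V) :
    adjPairs H A B + adjPairs H A Bᶜ = adjPairs H A Finset.univ := by
  simp only [adjPairs_eq, ← Finset.sum_add_distrib, Finset.sum_add_sum_compl]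

open scoped Classical in
theorem adjPairs_univ (A : Finset V) :
    adjPairs H Finset.univ Finset.univ = adjPairs H Aᶜ Aᶜ + 2 * adjPairs H Aᶜ A + adjPairs H A A := by
  rw [← adjPairs_add_compl_right Finset.univ A, adjPairs_comm Finset.univ A,
    adjPairs_comm Finset.univ Aᶜ, ← adjPairs_add_compl_right A A, ← adjPairs_add_compl_right Aᶜ A,
    adjPairs_comm A Aᶜ]
  ring

open scoped Classical in
theorem IsSwap.image_compl {M D : Finset V} {φ : V → V} (hφ : IsSwap H M D φ) :
    (Mᶜ).image φ = Dᶜ := by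
  ext y
  simp only [Finset.mem_image, Finset.mem_compl]
  constructor
  · rintro ⟨x, hx, rfl⟩; exact hφ.maps x hx
  · intro hy
    obtain ⟨x, hx, rfl⟩ := hφ.surj y hy
    exact ⟨x, hx, rfl⟩

open scoped Classical in
theorem IsSwap.card_eq {M D : Finset V} {φ : V → V} (hφ : IsSwap H M D φ) : D.card = M.card := by
  have h : (Dᶜ).card = (Mᶜ).card := by
    rw [← hφ.image_compl]
    exact Finset.card_image_of_injOn fun a ha b hb =>
      hφ.inj a (by simpa using ha) b (by simpa using hb)
  rw [Finset.card_compl, Finset.card_compl] at h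
  have := Finset.card_le_univ D
  have := Finset.card_le_univ M
  omega

end Count

/-! ### Scattered edges form a gadget -/

section Criterion

variable {V : Type u} {H : SimpleGraph V}

/-- The edges `a i — b i` lie outside `S`, and their closed neighborhoods in `H - S` are pairwise
disjoint. -/
structure IsScattered {ι : Type*} (H : SimpleGraph V) (S : Finset V) (a b : ι → V) : Prop where
  adj : ∀ i, H.Adj (a i) (b i)
  notMem_left : ∀ i, a i ∉ S
  notMem_right : ∀ i, b i ∉ S
  eq_of_mem : ∀ i j v, v ∉ S → (v = a i ∨ v = b i ∨ H.Adj v (a i) ∨ H.Adj v (b i)) →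
    (v = a j ∨ v = b j ∨ H.Adj v (a j) ∨ H.Adj v (b j)) → i = j

open scoped Classical in
/-- The set of endpoints of a family of edges. -/
noncomputable def endpoints {ι : Type*} [Fintype ι] (a b : ι → V) : Finset V :=
  Finset.univ.image a ∪ Finset.univ.image b

theorem mem_endpoints {ι : Type*} [Fintype ι] {a b : ι → V} {x : V} :
    x ∈ endpoints a b ↔ ∃ i, x = a i ∨ x = b i := by
  simp only [endpoints, Finset.mem_union, Finset.mem_image, Finset.mem_univ, true_and,
    exists_or, eq_comm]

variable {k t : ℕ} {S : Finset V} {a b : Fin k → V}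

theorem IsScattered.disjoint (h : IsScattered H S a b) : Disjoint (endpoints a b) S := by
  rw [Finset.disjoint_left]
  intro x hx
  obtain ⟨i, rfl | rfl⟩ := mem_endpoints.mp hx
  · exact h.notMem_left i
  · exact h.notMem_right i

theorem IsScattered.adj_iff_left (h : IsScattered H S a b) {i : Fin k} {y : V}
    (hy : y ∈ endpoints a b) : H.Adj (a i) y ↔ y = b i := by
  constructor
  · intro hadj
    obtain ⟨j, hj⟩ := mem_endpoints.mp hy
    have hij : i = j := h.eq_of_mem i j (a i) (h.notMem_left i) (Or.inl rfl) (by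
      rcases hj with rfl | rfl
      · exact Or.inr (Or.inr (Or.inl hadj))
      · exact Or.inr (Or.inr (Or.inr hadj)))
    subst hij
    rcases hj with rfl | rfl
    · exact absurd hadj (H.irrefl)
    · rfl
  · rintro rfl; exact h.adj i

theorem IsScattered.symm (h : IsScattered H S a b) : IsScattered H S b a where
  adj i := (h.adj i).symm
  notMem_left := h.notMem_right
  notMem_right := h.notMem_left
  eq_of_mem i j v hv h1 h2 := h.eq_of_mem i j v hv (by tauto) (by tauto)

theorem endpoints_comm (a b : Fin k → V) : endpoints a b = endpoints b a :=
  Finset.ext fun x => by simp only [mem_endpoints, or_comm]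

theorem IsScattered.adj_iff_right (h : IsScattered H S a b) {i : Fin k} {y : V}
    (hy : y ∈ endpoints a b) : H.Adj (b i) y ↔ y = a i :=
  h.symm.adj_iff_left (endpoints_comm a b ▸ hy)

theorem IsScattered.injective (h : IsScattered H S a b) :
    Function.Injective fun x : Fin k × Bool => if x.2 then b x.1 else a x.1 := by
  rintro ⟨i, s⟩ ⟨j, s'⟩ hxy
  have hij : i = j := by
    cases s <;> cases s' <;> simp only [if_true, if_false, Bool.false_eq_true] at hxy
    · exact h.eq_of_mem i j (a i) (h.notMem_left i) (by tauto) (by tauto)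
    · exact h.eq_of_mem i j (a i) (h.notMem_left i) (by tauto) (by tauto)
    · exact h.eq_of_mem i j (b i) (h.notMem_right i) (by tauto) (by tauto)
    · exact h.eq_of_mem i j (b i) (h.notMem_right i) (by tauto) (by tauto)
  subst hij
  have := (h.adj i).ne
  cases s <;> cases s' <;> simp_all

theorem IsScattered.isKMatching (h : IsScattered H S a b) :
    IsKMatching (H.induce (endpoints a b : Set V)) k := by
  have hmem : ∀ x : Fin k × Bool, (if x.2 then b x.1 else a x.1) ∈ endpoints a b := by
    rintro ⟨i, s⟩
    cases s
    · exact mem_endpoints.mpr ⟨i, Or.inl rfl⟩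
    · exact mem_endpoints.mpr ⟨i, Or.inr rfl⟩
  refine isKMatching_of_bijective (fun x => ⟨if x.2 then b x.1 else a x.1, hmem x⟩) ⟨?_, ?_⟩ ?_
  · intro x y hxy
    exact h.injective (congrArg Subtype.val hxy)
  · rintro ⟨y, hy⟩
    obtain ⟨i, rfl | rfl⟩ := mem_endpoints.mp hy
    · exact ⟨(i, false), rfl⟩
    · exact ⟨(i, true), rfl⟩
  · rintro ⟨i, s⟩ ⟨j, s'⟩
    have hi := h.injective.eq_iff (a := (j, s')) (b := (i, !s))
    have hm := hmem (j, s')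
    have hgoal : H.Adj (if s then b i else a i) (if s' then b j else a j) ↔ (j, s') = (i, !s) := by
      rw [← hi]
      cases s
      · simpa using h.adj_iff_left hm
      · simpa using h.adj_iff_right hm
    rw [SimpleGraph.comap_adj]
    refine hgoal.trans ?_
    simp only [Prod.mk.injEq]
    cases s <;> cases s' <;> simp [eq_comm]

theorem IsScattered.card_endpoints (h : IsScattered H S a b) : (endpoints a b).card = 2 * k := by
  classical
  have : endpoints a b =
      Finset.univ.image fun x : Fin k × Bool => if x.2 then b x.1 else a x.1 := by
    ext y
    simp only [mem_endpoints, Finset.mem_image, Finset.mem_univ, true_and, Prod.exists,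
      Bool.exists_bool, if_true, if_false, Bool.false_eq_true, eq_comm]
  rw [this, Finset.card_image_of_injective _ h.injective]
  simp [mul_comm]

open scoped Classical in
theorem IsScattered.adjPairs_endpoints (h : IsScattered H S a b) :
    adjPairs H (endpoints a b) (endpoints a b) ≤ 2 * k := by
  unfold adjPairs
  rw [← h.card_endpoints]
  refine (Finset.sum_le_card_nsmul _ _ 1 fun x hx => ?_).trans (by simp)
  rw [Finset.card_le_one]
  intro y hy z hz
  obtain ⟨hyM, hxy⟩ := Finset.mem_filter.mp hy
  obtain ⟨hzM, hxz⟩ := Finset.mem_filter.mp hz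
  obtain ⟨i, rfl | rfl⟩ := mem_endpoints.mp hx
  · rw [(h.adj_iff_left hyM).mp hxy, (h.adj_iff_left hzM).mp hxz]
  · rw [(h.adj_iff_right hyM).mp hxy, (h.adj_iff_right hzM).mp hxz]

open scoped Classical in
/-- The vertices of `A` with a neighbor in `M`. -/
noncomputable def touching (H : SimpleGraph V) (A M : Finset V) : Finset V :=
  A.filter fun x => ∃ m ∈ M, H.Adj x m

variable [Fintype V]

open scoped Classical in
-- A vertex outside `S` sees at most one of the scattered edges. It has at most one neighbor in `M`,
-- plus one more for a triangle on that edge.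
theorem IsScattered.adjPairs_le (h : IsScattered H S a b)
    (hcod : ∀ i, codegree H S (a i) (b i) ≤ t) :
    adjPairs H ((endpoints a b)ᶜ \ S) (endpoints a b) ≤
      (touching H ((endpoints a b)ᶜ \ S) (endpoints a b)).card + k * t := by
  set M := endpoints a b
  set A := Mᶜ \ S
  let X : V → Finset (Fin k) := fun x => Finset.univ.filter fun i => H.Adj x (a i) ∧ H.Adj x (b i)
  have hpt : ∀ x ∈ A, (M.filter fun y => H.Adj x y).card ≤
      (if ∃ m ∈ M, H.Adj x m then 1 else 0) + (X x).card := by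
    intro x hx
    have hxS : x ∉ S := (Finset.mem_sdiff.mp hx).2
    split_ifs with hex
    · obtain ⟨m, hm, hxm⟩ := hex
      obtain ⟨i, hi⟩ := mem_endpoints.mp hm
      have hxi : x = a i ∨ x = b i ∨ H.Adj x (a i) ∨ H.Adj x (b i) := by
        rcases hi with rfl | rfl <;> tauto
      have hsub : ∀ y ∈ M, H.Adj x y → y = a i ∨ y = b i := by
        intro y hy hxy
        obtain ⟨j, hj⟩ := mem_endpoints.mp hy
        have : i = j := h.eq_of_mem i j x hxS hxi (by rcases hj with rfl | rfl <;> tauto)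
        subst this
        exact hj
      by_cases hboth : H.Adj x (a i) ∧ H.Adj x (b i)
      · have h1 : 1 ≤ (X x).card := Finset.card_pos.mpr
          ⟨i, Finset.mem_filter.mpr ⟨Finset.mem_univ _, hboth⟩⟩
        have h2 : (M.filter fun y => H.Adj x y) ⊆ {a i, b i} := by
          intro y hy
          obtain ⟨hy, hxy⟩ := Finset.mem_filter.mp hy
          simpa using hsub y hy hxy
        have := (Finset.card_le_card h2).trans Finset.card_le_two
        omega
      · have : (M.filter fun y => H.Adj x y).card ≤ 1 := by
          rw [Finset.card_le_one]
          intro y hy z hz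
          obtain ⟨hy, hxy⟩ := Finset.mem_filter.mp hy
          obtain ⟨hz, hxz⟩ := Finset.mem_filter.mp hz
          rcases hsub y hy hxy with rfl | rfl <;> rcases hsub z hz hxz with rfl | rfl
          · rfl
          · exact absurd ⟨hxy, hxz⟩ hboth
          · exact absurd ⟨hxz, hxy⟩ hboth
          · rfl
        omega
    · have : M.filter (fun y => H.Adj x y) = ∅ := by
        rw [Finset.filter_eq_empty_iff]
        exact fun y hy hxy => hex ⟨y, hy, hxy⟩
      rw [this]
      simp
  unfold adjPairs
  refine (Finset.sum_le_sum hpt).trans ?_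
  rw [Finset.sum_add_distrib]
  refine add_le_add (le_of_eq ?_) ?_
  · rw [touching, Finset.card_filter]
  · simp only [X, Finset.card_filter]
    rw [Finset.sum_comm]
    refine (Finset.sum_le_card_nsmul _ _ t fun i _ => ?_).trans (by simp)
    rw [← Finset.card_filter]
    refine le_trans (Finset.card_le_card fun x hx => ?_) (hcod i)
    obtain ⟨hx, hx'⟩ := Finset.mem_filter.mp hx
    exact Finset.mem_filter.mpr ⟨Finset.mem_univ _, (Finset.mem_sdiff.mp hx).2, hx'⟩

open scoped Classical in
-- The larger color class `L` has at least k vertices. Choose an edge at each of them. A vertex that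
-- forms triangles with j ≥ 1 chosen edges has j neighbors in `L` and at least one outside `L`,
-- hence j + 1 in `D`.
theorem le_adjPairs_of_bipartite {D : Finset V} (hcard : D.card = 2 * k) (χ : V → Fin 2)
    (hχ : ∀ x ∈ D, ∀ y ∈ D, H.Adj x y → χ x ≠ χ y) (hiso : ∀ x ∈ D, ∃ y ∈ D, H.Adj x y)
    (hcod : ∀ x ∈ D, ∀ y ∈ D, H.Adj x y → t ≤ codegree H S x y) :
    (touching H (Dᶜ \ S) D).card + k * t ≤ adjPairs H (Dᶜ \ S) D := by
  obtain ⟨L, hLD, hLk, hLadj⟩ : ∃ L ⊆ D, k ≤ L.card ∧ ∀ x ∈ L, ∀ y ∈ D, H.Adj x y → y ∉ L := by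
    have hsum := Finset.card_filter_add_card_filter_not (s := D) (fun v => χ v = 0)
    rcases le_or_gt k (D.filter fun v => χ v = 0).card with h | h
    · refine ⟨D.filter fun v => χ v = 0, Finset.filter_subset _ _, h, fun x hx y hy hxy hy' => ?_⟩
      have h1 := (Finset.mem_filter.mp hx)
      have h2 := (Finset.mem_filter.mp hy').2
      exact hχ x h1.1 y hy hxy (h1.2.trans h2.symm)
    · refine ⟨D.filter fun v => ¬ χ v = 0, Finset.filter_subset _ _, by omega,
        fun x hx y hy hxy hy' => ?_⟩
      have h1 := (Finset.mem_filter.mp hx)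
      have h2 := (Finset.mem_filter.mp hy').2
      have := hχ x h1.1 y hy hxy
      have := h1.2
      omega
  choose! c hcD hc using hiso
  set A := Dᶜ \ S
  let X : V → Finset V := fun y => L.filter fun x => H.Adj y x ∧ H.Adj y (c x)
  have hpt : ∀ y ∈ A, (if ∃ m ∈ D, H.Adj y m then 1 else 0) + (X y).card ≤
      (D.filter fun x => H.Adj y x).card := by
    intro y _
    have hXsub : X y ⊆ D.filter fun x => H.Adj y x := by
      intro x hx
      obtain ⟨hx, hx'⟩ := Finset.mem_filter.mp hx
      exact Finset.mem_filter.mpr ⟨hLD hx, hx'.1⟩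
    split_ifs with hex
    · rw [add_comm]
      rcases (X y).eq_empty_or_nonempty with hX | ⟨x, hx⟩
      · obtain ⟨m, hm, hym⟩ := hex
        rw [hX, Finset.card_empty, zero_add]
        exact Finset.card_pos.mpr ⟨m, Finset.mem_filter.mpr ⟨hm, hym⟩⟩
      · obtain ⟨hxL, hx'⟩ := Finset.mem_filter.mp hx
        have hnot : c x ∉ X y := fun h =>
          hLadj x hxL (c x) (hcD x (hLD hxL)) (hc x (hLD hxL)) (Finset.mem_filter.mp h).1
        rw [← Finset.card_insert_of_notMem hnot]
        refine Finset.card_le_card (Finset.insert_subset ?_ hXsub)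
        exact Finset.mem_filter.mpr ⟨hcD x (hLD hxL), hx'.2⟩
    · rw [zero_add]
      exact Finset.card_le_card hXsub
  unfold adjPairs
  refine le_trans ?_ (Finset.sum_le_sum hpt)
  rw [Finset.sum_add_distrib]
  refine add_le_add (le_of_eq ?_) ?_
  · rw [touching, Finset.card_filter]
  · simp only [X, Finset.card_filter]
    rw [Finset.sum_comm]
    refine le_trans ?_ (Finset.card_nsmul_le_sum _ _ t fun x hx => ?_)
    · exact Nat.mul_le_mul_right t hLk
    · rw [← Finset.card_filter]
      have hxD := hLD hx
      refine (hcod x hxD (c x) (hcD x hxD) (hc x hxD)).trans (Finset.card_le_card fun y hy => ?_)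
      obtain ⟨-, hyS, hyx, hyc⟩ := Finset.mem_filter.mp hy
      refine Finset.mem_filter.mpr ⟨?_, hyx, hyc⟩
      rw [Finset.mem_sdiff, Finset.mem_compl]
      -- The third vertex of the triangle is outside `D`, since a bipartite graph has no triangle.
      refine ⟨fun hyD => ?_, hyS⟩
      have h1 := hχ y hyD x hxD hyx
      have h2 := hχ y hyD _ (hcD x hxD) hyc
      have h3 := hχ x hxD _ (hcD x hxD) (hc x hxD)
      omega

open scoped Classical in
-- Split all adjacent pairs of `H` along `M` and along `D`. The parts away from the deleted set
-- agree, so more pairs leaving `D` force fewer pairs inside it.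
theorem IsSwap.adjPairs_le {M D : Finset V} {φ : V → V} (hφ : IsSwap H M D φ)
    (hMS : Disjoint M S) (hS : ∀ x ∈ S, φ x ∈ S) (hMM : adjPairs H M M ≤ 2 * k)
    (hMC : adjPairs H (Mᶜ \ S) M ≤ (touching H (Mᶜ \ S) M).card + k * t)
    (hDC : (touching H (Dᶜ \ S) D).card + k * t ≤ adjPairs H (Dᶜ \ S) D) :
    adjPairs H D D ≤ 2 * k := by
  have himS : S.image φ = S := by
    refine Finset.eq_of_subset_of_card_le ?_ ?_
    · intro y hy
      obtain ⟨x, hx, rfl⟩ := Finset.mem_image.mp hy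
      exact hS x hx
    · rw [Finset.card_image_of_injOn]
      exact fun x hx y hy => hφ.inj x (fun h => Finset.disjoint_left.mp hMS h hx) y
        (fun h => Finset.disjoint_left.mp hMS h hy)
  have hMM' : Disjoint M Mᶜ := disjoint_compl_right
  have e1 : adjPairs H Mᶜ Mᶜ = adjPairs H Dᶜ Dᶜ :=
    hφ.adjPairs_eq hMM' hMM' hφ.image_compl hφ.image_compl
  have e2 : adjPairs H S Mᶜ = adjPairs H S Dᶜ := hφ.adjPairs_eq hMS hMM' himS hφ.image_compl
  -- The degree sum over `S` is the same on both sides, and the contributions of the two complements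
  -- agree by `e2`.
  have e3 : adjPairs H S M = adjPairs H S D := by
    have h1 := adjPairs_add_compl_right (H := H) S M
    have h2 := adjPairs_add_compl_right (H := H) S D
    omega
  have hSsub : S ⊆ Mᶜ := fun x hx => Finset.mem_compl.mpr
    fun h => Finset.disjoint_left.mp hMS h hx
  have hSsub' : S ⊆ Dᶜ := by
    rw [← himS, ← hφ.image_compl]
    exact Finset.image_subset_image hSsub
  have e4 : (touching H (Mᶜ \ S) M).card = (touching H (Dᶜ \ S) D).card := by
    refine Finset.card_bij (fun x _ => φ x) ?_ ?_ ?_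
    · intro x hx
      obtain ⟨hx, hx'⟩ := Finset.mem_filter.mp hx
      obtain ⟨hxM, hxS⟩ := Finset.mem_sdiff.mp hx
      rw [Finset.mem_compl] at hxM
      refine Finset.mem_filter.mpr ⟨Finset.mem_sdiff.mpr ⟨Finset.mem_compl.mpr (hφ.maps x hxM), ?_⟩,
        (hφ.bdry x hxM).mp hx'⟩
      exact fun h => hxS ((hφ.mem_iff hMS hS hxM).mp h)
    · intro x hx y hy
      obtain ⟨hx, -⟩ := Finset.mem_filter.mp hx
      obtain ⟨hy, -⟩ := Finset.mem_filter.mp hy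
      exact hφ.inj x (Finset.mem_compl.mp (Finset.mem_sdiff.mp hx).1) y
        (Finset.mem_compl.mp (Finset.mem_sdiff.mp hy).1)
    · intro y hy
      obtain ⟨hy, hy'⟩ := Finset.mem_filter.mp hy
      obtain ⟨hyD, hyS⟩ := Finset.mem_sdiff.mp hy
      obtain ⟨x, hx, rfl⟩ := hφ.surj y (Finset.mem_compl.mp hyD)
      refine ⟨x, Finset.mem_filter.mpr ⟨Finset.mem_sdiff.mpr ⟨Finset.mem_compl.mpr hx,
        fun h => hyS (hS x h)⟩, (hφ.bdry x hx).mpr hy'⟩, rfl⟩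
  have e5 := adjPairs_add_sdiff_left (H := H) hSsub M
  have e6 := adjPairs_add_sdiff_left (H := H) hSsub' D
  have e7 := adjPairs_univ (H := H) M
  have e8 := adjPairs_univ (H := H) D
  omega

theorem isMatchingGadget_of_isScattered {Y : Finset V} (h : IsScattered H S a b)
    (hcod : ∀ i, codegree H S (a i) (b i) ≤ t) (hprot : IsProtected H S (endpoints a b))
    (hY : Covers Y (LowEdge H S t)) (hYM : Disjoint Y (closedNbhd H S (endpoints a b))) :
    IsMatchingGadget H k (endpoints a b : Set V) := by
  classical
  refine ⟨h.isKMatching, ?_⟩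
  set M := endpoints a b
  intro C' f hiso hbip hbp
  let D : Finset V := (Set.toFinite C'ᶜ).toFinset
  have hD : ∀ x, x ∈ D ↔ x ∉ C' := by simp [D]
  have hDset : (D : Set V) = C'ᶜ := (Set.toFinite C'ᶜ).coe_toFinset
  let φ : V → V := fun x => if hx : x ∈ (M : Set V)ᶜ then f ⟨x, hx⟩ else x
  have hφf : ∀ x (hx : x ∈ (M : Set V)ᶜ), φ x = f ⟨x, hx⟩ := fun x hx => dif_pos hx
  have hmem : ∀ x, x ∉ M → x ∈ (M : Set V)ᶜ := fun x hx => by simpa using hx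
  have hφ : IsSwap H M D φ := by
    refine ⟨fun x hx => ?_, fun x hx y hy hxy => ?_, fun y hy => ?_, fun x hx y hy => ?_,
      fun x hx => ?_⟩
    · rw [hφf x (hmem x hx), hD, not_not]
      exact (f _).2
    · rw [hφf x (hmem x hx), hφf y (hmem y hy)] at hxy
      have := f.injective (Subtype.ext hxy)
      exact congrArg Subtype.val this
    · have hyC : y ∈ C' := by rwa [hD, not_not] at hy
      obtain ⟨⟨x, hx⟩, hxy⟩ := f.surjective ⟨y, hyC⟩
      refine ⟨x, by simpa using hx, ?_⟩
      rw [hφf x hx, hxy]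
    · rw [hφf x (hmem x hx), hφf y (hmem y hy)]
      exact f.map_adj_iff
    · have h1 : (∃ m ∈ M, H.Adj x m) ↔ x ∈ vertexBoundary H (M : Set V)ᶜ := by
        simp [vertexBoundary, hx]
      have h2 : (∃ w ∈ D, H.Adj (φ x) w) ↔ (f ⟨x, hmem x hx⟩ : V) ∈ vertexBoundary H C' := by
        rw [hφf x (hmem x hx)]
        simp [vertexBoundary, hD]
      rw [h1, h2, ← hbp]
      constructor
      · exact fun hb => ⟨⟨x, hmem x hx⟩, hb, rfl⟩
      · rintro ⟨z, hz, hzx⟩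
        have := f.injective (Subtype.ext hzx)
        rw [this] at hz
        exact hz
  have hS := hprot D φ hφ
  have hcardD : D.card = 2 * k := by rw [hφ.card_eq, h.card_endpoints]
  have hisoD : ∀ x ∈ D, ∃ y ∈ D, H.Adj x y := by
    intro x hx
    have := hiso ⟨x, (hD x).mp hx⟩
    simp only [SimpleGraph.IsIsolated, not_forall, not_not] at this
    obtain ⟨y, hy⟩ := this
    exact ⟨y, (hD y).mpr y.2, hy⟩
  have hDS : Disjoint D S := by
    rw [Finset.disjoint_left]
    intro x hxD hxS
    have hSM : ∀ s ∈ S, s ∉ M := fun s hs hm => Finset.disjoint_left.mp h.disjoint hm hs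
    obtain ⟨s, hs, hsx⟩ := Finset.surjOn_of_injOn_of_card_le φ hS
      (fun x hx y hy => hφ.inj x (hSM x hx) y (hSM y hy)) le_rfl hxS
    exact hφ.maps s (hSM s hs) (hsx ▸ hxD)
  have hle : adjPairs H D D ≤ 2 * k := by
    obtain ⟨χ⟩ := id hbip
    let χ' : V → Fin 2 := fun x => if hx : x ∈ C'ᶜ then χ ⟨x, hx⟩ else 0
    refine hφ.adjPairs_le h.disjoint hS h.adjPairs_endpoints (h.adjPairs_le hcod)
      (le_adjPairs_of_bipartite hcardD χ' ?_ hisoD ?_)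
    · intro x hx y hy hxy
      have hx' : x ∈ C'ᶜ := (hD x).mp hx
      have hy' : y ∈ C'ᶜ := (hD y).mp hy
      simp only [χ', dif_pos hx', dif_pos hy']
      exact χ.valid (v := ⟨x, hx'⟩) (w := ⟨y, hy'⟩) hxy
    · intro x hx y hy hxy
      by_contra hlt
      exact hφ.not_lowEdge h.disjoint hS hY hYM hx
        ⟨fun h' => Finset.disjoint_left.mp hDS hx h', fun h' => Finset.disjoint_left.mp hDS hy h',
          hxy, not_le.mp hlt⟩
  have hdeg : ∀ x ∈ D, (D.filter fun y => H.Adj x y).card = 1 := by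
    have hge : ∀ x ∈ D, 1 ≤ (D.filter fun y => H.Adj x y).card := fun x hx => by
      obtain ⟨y, hy, hxy⟩ := hisoD x hx
      exact Finset.card_pos.mpr ⟨y, Finset.mem_filter.mpr ⟨hy, hxy⟩⟩
    -- All degrees in `D` are at least 1 and sum to at most `2 * k = D.card`, so each equals 1.
    have hsum : ∑ x ∈ D, 1 = ∑ x ∈ D, (D.filter fun y => H.Adj x y).card := by
      refine le_antisymm (Finset.sum_le_sum hge) ?_
      rw [Finset.sum_const, smul_eq_mul, mul_one, hcardD]
      unfold adjPairs at hle
      convert hle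
    intro x hx
    exact ((Finset.sum_eq_sum_iff_of_le hge).mp hsum x hx).symm
  refine isKMatching_of_existsUnique_adj (fun x => ?_) hbip ?_
  · obtain ⟨y, hy⟩ := Finset.card_eq_one.mp (hdeg x ((hD x).mpr x.2))
    have hmemy : ∀ z, (z ∈ D ∧ H.Adj x z) ↔ z = y := fun z => by
      rw [← Finset.mem_singleton, ← hy, Finset.mem_filter]
    have hyD := (hmemy y).mpr rfl
    refine ⟨⟨y, (hD y).mp hyD.1⟩, hyD.2, fun z hz =>
      Subtype.ext ((hmemy z).mp ⟨(hD z).mpr z.2, hz⟩)⟩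
  · rw [← hcardD, ← Set.ncard_coe_finset, hDset, ← Nat.card_coe_set_eq, Nat.card_eq_fintype_card]

end Criterion

/-! ### Counting in graphs of bounded treewidth -/

section Sparse

/-- Each related pair is charged to one of its two members. -/
theorem sum_card_filter_le {α β : Type*} [DecidableEq α] [DecidableEq β] {X : Finset α}
    {Y : Finset β} {R : α → β → Prop} [∀ x, DecidablePred (R x)] (A : α → Finset β)
    (B : β → Finset α) {m n : ℕ} (hA : ∀ x ∈ X, (A x).card ≤ m) (hB : ∀ y ∈ Y, (B y).card ≤ n)
    (hR : ∀ x ∈ X, ∀ y ∈ Y, R x y → y ∈ A x ∨ x ∈ B y) :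
    ∑ x ∈ X, (Y.filter (R x)).card ≤ m * X.card + n * Y.card := by
  have h1 : ∀ x ∈ X, (Y.filter (R x)).card ≤ m + (Y.filter fun y => x ∈ B y).card := by
    intro x hx
    refine le_trans (Finset.card_le_card (t := A x ∪ Y.filter fun y => x ∈ B y) ?_)
      ((Finset.card_union_le _ _).trans (Nat.add_le_add_right (hA x hx) _))
    intro y hy
    obtain ⟨hy, hxy⟩ := Finset.mem_filter.mp hy
    rcases hR x hx y hy hxy with h | h
    · exact Finset.mem_union_left _ h
    · exact Finset.mem_union_right _ (Finset.mem_filter.mpr ⟨hy, h⟩)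
  refine (Finset.sum_le_sum h1).trans ?_
  rw [Finset.sum_add_distrib, Finset.sum_const, smul_eq_mul, mul_comm X.card]
  refine Nat.add_le_add_left ?_ _
  simp only [Finset.card_filter]
  rw [Finset.sum_comm]
  refine (Finset.sum_le_card_nsmul _ _ n fun y hy => ?_).trans (by simp [mul_comm])
  rw [← Finset.card_filter]
  refine le_trans (Finset.card_le_card fun x hx => ?_) (hB y hy)
  exact (Finset.mem_filter.mp hx).2

variable {V : Type u} {H : SimpleGraph V} {b : ℕ}

theorem connected_induce_singleton (v : V) : (H.induce {v}).Connected := by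
  have : Nonempty ({v} : Set V) := ⟨⟨v, rfl⟩⟩
  refine ⟨fun x y => ?_⟩
  rw [Subsingleton.elim x y]

theorem connected_induce_star {K : Set V} {c : V} (hc : c ∈ K) (hK : ∀ x ∈ K, x = c ∨ H.Adj c x) :
    (H.induce K).Connected := by
  rw [SimpleGraph.connected_iff_exists_forall_reachable]
  refine ⟨⟨c, hc⟩, fun x => ?_⟩
  rcases hK x x.2 with h | h
  · rw [show x = ⟨c, hc⟩ from Subtype.ext h]
  · exact SimpleGraph.Adj.reachable (G := H.induce K) (u := ⟨c, hc⟩) (v := x) h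

theorem connected_induce_doubleStar {K : Set V} {c d : V} (hc : c ∈ K) (hd : d ∈ K)
    (hcd : H.Adj c d) (hK : ∀ x ∈ K, x = c ∨ x = d ∨ H.Adj c x ∨ H.Adj d x) :
    (H.induce K).Connected := by
  rw [SimpleGraph.connected_iff_exists_forall_reachable]
  have hr : (H.induce K).Reachable ⟨c, hc⟩ ⟨d, hd⟩ :=
    SimpleGraph.Adj.reachable (G := H.induce K) (u := ⟨c, hc⟩) (v := ⟨d, hd⟩) hcd
  refine ⟨⟨c, hc⟩, fun x => ?_⟩
  rcases hK x x.2 with h | h | h | h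
  · rw [show x = ⟨c, hc⟩ from Subtype.ext h]
  · rw [show x = ⟨d, hd⟩ from Subtype.ext h]
    exact hr
  · exact SimpleGraph.Adj.reachable (G := H.induce K) (u := ⟨c, hc⟩) (v := x) h
  · exact hr.trans (SimpleGraph.Adj.reachable (G := H.induce K) (u := ⟨d, hd⟩) (v := x) h)

/-- An edge is charged to the endpoint of higher level, whose top contains the other endpoint. -/
theorem HasSmallTops.adjPairs_le (hH : HasSmallTops H b) (P Z : Finset V) :
    adjPairs H P Z ≤ b * P.card + b * Z.card := by
  classical
  obtain ⟨lev, top, htop, h⟩ := hH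
  unfold adjPairs
  refine sum_card_filter_le (fun u => top {u}) (fun z => top {z}) (fun _ _ => htop _)
    (fun _ _ => htop _) fun u _ z _ huz => ?_
  rcases le_total (lev {z}) (lev {u}) with hl | hl
  · obtain ⟨v, hv, rfl⟩ := h {u} {z} (connected_induce_singleton u) (connected_induce_singleton z)
      ⟨u, rfl, z, rfl, Or.inr huz⟩ hl
    exact Or.inl hv
  · obtain ⟨v, hv, rfl⟩ := h {z} {u} (connected_induce_singleton z) (connected_induce_singleton u)
      ⟨z, rfl, u, rfl, Or.inr huz.symm⟩ hl
    exact Or.inr hv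

/-- A family of connected sets in which every vertex has small multiplicity contains many
pairwise disjoint members. -/
theorem HasSmallTops.exists_pairwiseDisjoint {ι : Type*} (hH : HasSmallTops H b) (E : Finset ι)
    (K : ι → Finset V) (hK : ∀ e ∈ E, (H.induce (K e : Set V)).Connected) {q : ℝ}
    (hq : ∀ x, (({e ∈ E | x ∈ K e} : Set ι).ncard : ℝ) ≤ q) :
    ∃ D ⊆ E, (D : Set ι).PairwiseDisjoint K ∧ (E.card : ℝ) ≤ b * q * D.card := by
  classical
  obtain ⟨lev, top, htop, h⟩ := hH
  have hq' : ∀ x, ((E.filter fun e => x ∈ K e).card : ℝ) ≤ q := fun x => by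
    rw [← Set.ncard_coe_finset, Finset.coe_filter]
    exact hq x
  clear hq
  induction E using Finset.strongInduction with
  | H E ih =>
    rcases E.eq_empty_or_nonempty with rfl | hne
    · exact ⟨∅, Finset.Subset.refl _, by simp, by simp⟩
    -- Greedy choice: every set that meets `K e` meets its top, so at most `b * q` sets are
    -- discarded with it.
    obtain ⟨e, he, hmax⟩ := Finset.exists_max_image E (fun e => lev (K e)) hne
    let E' := E.filter fun e' => Disjoint (K e') (top (K e))
    have htopmeet : ∀ e' ∈ E, ¬ Disjoint (K e') (K e) → ¬ Disjoint (K e') (top (K e)) := by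
      intro e' he' hnd
      obtain ⟨x, hx, hx'⟩ := Finset.not_disjoint_iff.mp hnd
      obtain ⟨v, hv, hv'⟩ := h (K e) (K e') (hK e he) (hK e' he') ⟨x, hx', x, hx, Or.inl rfl⟩
        (hmax e' he')
      exact Finset.not_disjoint_iff.mpr ⟨v, hv', hv⟩
    have heE' : e ∉ E' := by
      intro hmem
      refine htopmeet e he ?_ (Finset.mem_filter.mp hmem).2
      obtain ⟨x⟩ := (hK e he).nonempty
      exact Finset.not_disjoint_iff.mpr ⟨x, x.2, x.2⟩
    have hsub : E' ⊆ E := Finset.filter_subset _ _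
    obtain ⟨D, hDE, hD, hcard⟩ := ih E' (hsub.ssubset_of_mem_notMem he heE')
      (fun e he => hK e (hsub he)) (fun x => le_trans (by
        exact_mod_cast Finset.card_le_card (Finset.filter_subset_filter _ hsub)) (hq' x))
    have heD : e ∉ D := fun h => heE' (hDE h)
    refine ⟨insert e D, Finset.insert_subset he (hDE.trans hsub), ?_, ?_⟩
    · rw [Finset.coe_insert]
      refine hD.insert fun e' he' _ => ?_
      by_contra hnd
      exact htopmeet e' (hsub (hDE he')) (fun hd => hnd hd.symm) (Finset.mem_filter.mp (hDE he')).2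
    · have h1 : (E \ E').card ≤ ∑ x ∈ top (K e), (E.filter fun e' => x ∈ K e').card := by
        refine le_trans (Finset.card_le_card ?_) Finset.card_biUnion_le
        intro e' he'
        obtain ⟨he', hn⟩ := Finset.mem_sdiff.mp he'
        have hnd : ¬ Disjoint (K e') (top (K e)) := fun hd => hn (Finset.mem_filter.mpr ⟨he', hd⟩)
        obtain ⟨x, hx, hx'⟩ := Finset.not_disjoint_iff.mp hnd
        exact Finset.mem_biUnion.mpr ⟨x, hx', Finset.mem_filter.mpr ⟨he', hx⟩⟩
      have hq0 : 0 ≤ q := by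
        obtain ⟨x⟩ := (hK e he).nonempty
        exact le_trans (Nat.cast_nonneg _) (hq' x)
      have h2 : ((E \ E').card : ℝ) ≤ b * q := by
        refine le_trans (Nat.cast_le.mpr h1) ?_
        push_cast
        refine (Finset.sum_le_card_nsmul _ _ q fun x _ => hq' x).trans ?_
        rw [nsmul_eq_mul]
        exact mul_le_mul_of_nonneg_right (by exact_mod_cast htop _) hq0
      have h3 : (E.card : ℝ) = (E \ E').card + E'.card := by
        exact_mod_cast (Finset.card_sdiff_add_card_eq_card hsub).symm
      rw [Finset.card_insert_of_notMem heD, h3]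
      push_cast
      linarith

variable [Fintype V]

open scoped Classical in
/-- The vertices with more than `b` neighbors in `Z`. -/
noncomputable def richVertices (H : SimpleGraph V) (b : ℕ) (Z : Finset V) : Finset V :=
  Finset.univ.filter fun u => b < (Z.filter fun z => H.Adj u z).card

theorem HasSmallTops.card_richVertices_le (hH : HasSmallTops H b) (Z : Finset V) :
    (richVertices H b Z).card ≤ b * Z.card := by
  classical
  have h1 := hH.adjPairs_le (richVertices H b Z) Z
  have h2 : (b + 1) * (richVertices H b Z).card ≤ adjPairs H (richVertices H b Z) Z := by
    unfold adjPairs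
    rw [mul_comm, ← smul_eq_mul]
    exact Finset.card_nsmul_le_sum _ _ _ fun u hu => (Finset.mem_filter.mp hu).2
  nlinarith

/-- Double counting of pairs in `Z × Y` at distance at most two, where the middle vertex is neither
in `Z` nor in the set `P` of vertices with many neighbors in `Z`. At most (b+1)|Z| vertices are
excluded, so each hub retains many partners in `Y`. From above, the pairs are bounded by the tops of
stars and singletons. -/
theorem HasSmallTops.card_mul_le_of_subset_hubs (hH : HasSmallTops H b) {S Y Z : Finset V}
    {F : V → V → Prop} {h : ℝ} (hF : ∀ u v, F u v → H.Adj u v) (hY : Covers Y F)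
    (hZ : Z ⊆ hubs H S F h) :
    (Z.card : ℝ) * (h - (b + 1) * Z.card) ≤ b * Z.card + (b + b * b) * Y.card := by
  classical
  set P := richVertices H b Z
  have hPcard : (P.card : ℝ) ≤ b * Z.card := by exact_mod_cast hH.card_richVertices_le Z
  let R : V → V → Prop := fun z y => (y = z ∨ H.Adj z y) ∨ ∃ u, u ∉ P ∪ Z ∧ H.Adj z u ∧ H.Adj u y
  have hcov : ∀ z ∈ Z, Covers (Y.filter (R z) ∪ (P ∪ Z)) (NearEdge H F z) := by
    intro z hz
    have key : ∀ u v, F u v → (u = z ∨ H.Adj z u) → (u ∈ Y ∨ v ∈ Y) →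
        u ∈ Y.filter (R z) ∪ (P ∪ Z) ∨ v ∈ Y.filter (R z) ∪ (P ∪ Z) := by
      intro u v huv hu hcover
      by_cases huPZ : u ∈ P ∪ Z
      · exact Or.inl (Finset.mem_union_right _ huPZ)
      rcases hu with rfl | hu
      · exact absurd (Finset.mem_union_right _ hz) huPZ
      rcases hcover with h' | h'
      · exact Or.inl (Finset.mem_union_left _ (Finset.mem_filter.mpr ⟨h', Or.inl (Or.inr hu)⟩))
      · exact Or.inr (Finset.mem_union_left _
          (Finset.mem_filter.mpr ⟨h', Or.inr ⟨u, huPZ, hu, hF u v huv⟩⟩))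
    have key' : ∀ u v, F u v → (v = z ∨ H.Adj z v) → (u ∈ Y ∨ v ∈ Y) →
        u ∈ Y.filter (R z) ∪ (P ∪ Z) ∨ v ∈ Y.filter (R z) ∪ (P ∪ Z) := by
      intro u v huv hv hcover
      by_cases hvPZ : v ∈ P ∪ Z
      · exact Or.inr (Finset.mem_union_right _ hvPZ)
      rcases hv with rfl | hv
      · exact absurd (Finset.mem_union_right _ hz) hvPZ
      rcases hcover with h' | h'
      · exact Or.inl (Finset.mem_union_left _
          (Finset.mem_filter.mpr ⟨h', Or.inr ⟨v, hvPZ, hv, (hF u v huv).symm⟩⟩))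
      · exact Or.inr (Finset.mem_union_left _ (Finset.mem_filter.mpr ⟨h', Or.inl (Or.inr hv)⟩))
    rintro u v ⟨huv, hu | hv⟩
    · exact key u v huv hu (hY u v huv)
    · exact key' u v huv hv (hY u v huv)
  have hlow : ∀ z ∈ Z, h - (b + 1) * Z.card ≤ ((Y.filter (R z)).card : ℝ) := by
    intro z hz
    have h1 := (mem_hubs.mp (hZ hz)).2 _ (hcov z hz)
    have h2 : ((Y.filter (R z) ∪ (P ∪ Z)).card : ℝ) ≤ (Y.filter (R z)).card + (P.card + Z.card) := by
      exact_mod_cast (Finset.card_union_le _ _).trans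
        (Nat.add_le_add_left (Finset.card_union_le _ _) _)
    linarith
  have hup : ∑ z ∈ Z, (Y.filter (R z)).card ≤ b * Z.card + (b + b * b) * Y.card := by
    obtain ⟨lev, top, htop, htops⟩ := hH
    let K : V → Set V := fun z => {x | x = z ∨ (x ∉ P ∪ Z ∧ H.Adj z x)}
    have hKconn : ∀ z, (H.induce (K z)).Connected := fun z =>
      connected_induce_star (c := z) (Or.inl rfl) fun x hx => hx.imp id fun h => h.2
    -- If the top of `{y}` meets the star of `z`, it contains `z` or a neighbor of `z` outside `P`,
    -- which has at most `b` neighbors in `Z`. Hence the constant `b + b * b`.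
    refine sum_card_filter_le (fun z => top (K z))
      (fun y => top {y} ∪ ((top {y}).filter fun x => x ∉ P).biUnion
        fun x => Z.filter fun z => H.Adj x z) (fun _ _ => htop _) ?_ ?_
    · intro y _
      refine (Finset.card_union_le _ _).trans (Nat.add_le_add (htop _) ?_)
      refine Finset.card_biUnion_le.trans ((Finset.sum_le_card_nsmul _ _ b fun x hx => ?_).trans ?_)
      · by_contra hlt
        exact (Finset.mem_filter.mp hx).2
          (Finset.mem_filter.mpr ⟨Finset.mem_univ _, not_le.mp hlt⟩)
      · rw [smul_eq_mul]
        exact Nat.mul_le_mul_right _ ((Finset.card_filter_le _ _).trans (htop _))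
    · intro z hz y _ hzy
      have htouch : ∃ x ∈ K z, ∃ y' ∈ ({y} : Set V), x = y' ∨ H.Adj x y' := by
        rcases hzy with (rfl | h') | ⟨u, hu, hzu, huy⟩
        · exact ⟨y, Or.inl rfl, y, rfl, Or.inl rfl⟩
        · exact ⟨z, Or.inl rfl, y, rfl, Or.inr h'⟩
        · exact ⟨u, Or.inr ⟨hu, hzu⟩, y, rfl, Or.inr huy⟩
      rcases le_total (lev {y}) (lev (K z)) with hl | hl
      · obtain ⟨v, hv, rfl⟩ := htops _ _ (hKconn z) (connected_induce_singleton y) htouch hl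
        exact Or.inl hv
      · obtain ⟨x, hx, y', hy', hxy⟩ := htouch
        obtain ⟨v, hv, hvK⟩ := htops _ _ (connected_induce_singleton y) (hKconn z)
          ⟨y', hy', x, hx, hxy.imp Eq.symm fun h => h.symm⟩ hl
        right
        rcases hvK with rfl | ⟨hvPZ, hzv⟩
        · exact Finset.mem_union_left _ hv
        · refine Finset.mem_union_right _ (Finset.mem_biUnion.mpr ⟨v, Finset.mem_filter.mpr
            ⟨hv, fun h => hvPZ (Finset.mem_union_left _ h)⟩, Finset.mem_filter.mpr ⟨hz, hzv.symm⟩⟩)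
  have h1 : (Z.card : ℝ) * (h - (b + 1) * Z.card) ≤ ∑ z ∈ Z, ((Y.filter (R z)).card : ℝ) := by
    rw [← nsmul_eq_mul]
    exact Finset.card_nsmul_le_sum _ _ _ hlow
  refine h1.trans ?_
  exact_mod_cast hup

/-- There is only a bounded number of vertices near which a positive proportion of `F` lies. -/
theorem HasSmallTops.card_hubs_lt (hH : HasSmallTops H b) {S Y : Finset V}
    {F : V → V → Prop} (hF : ∀ u v, F u v → H.Adj u v) (hY : Covers Y F) {ε : ℝ} {p : ℕ}
    (hp : 2 * (b + b * b + 1 : ℝ) ≤ ε * p) (hn : (b + 1) * (p * p) + b * p < Y.card) :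
    (hubs H S F (ε * Y.card)).card < p := by
  by_contra hlt
  obtain ⟨Z, hZ, hZp⟩ := Finset.exists_subset_card_eq (not_lt.mp hlt)
  have h1 := hH.card_mul_le_of_subset_hubs hF hY hZ
  rw [hZp] at h1
  have hn' : ((b + 1) * (p * p) + b * p : ℝ) < Y.card := by exact_mod_cast hn
  have h2 : 2 * (b + b * b + 1 : ℝ) * Y.card ≤ ε * p * Y.card :=
    mul_le_mul_of_nonneg_right hp (Nat.cast_nonneg _)
  have h3 : (0 : ℝ) ≤ (b + b * b) * Y.card := by positivity
  nlinarith

/-- Edges in few triangles carry a constant proportion of the vertex cover number. -/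
theorem HasSmallTops.exists_covers_adj (hH : HasSmallTops H b) (hb : 0 < b) {Y : Finset V}
    (hY : Covers Y (LowEdge H ∅ (3 * b + 1))) :
    ∃ X : Finset V, Covers X H.Adj ∧ X.card ≤ 2 * Y.card := by
  classical
  -- Sparsity gives `adjPairs H X X ≤ 2 * b * X.card`, so comparison with `Y` bounds `X`, and
  -- comparison with `insert v X` leaves each outer `v` at most `2 * b` neighbors in `X`.
  obtain ⟨X, hX, hmax⟩ := Finset.exists_max_image (Finset.univ.filter fun X : Finset V => Y ⊆ X)
    (fun X => (adjPairs H X X : ℤ) - 4 * b * X.card) ⟨Y, by simp⟩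
  have hYX : Y ⊆ X := (Finset.mem_filter.mp hX).2
  have hcard : X.card ≤ 2 * Y.card := by
    have h1 := hmax Y (by simp)
    have h2 : (adjPairs H X X : ℤ) ≤ b * X.card + b * X.card := by exact_mod_cast hH.adjPairs_le X X
    have h3 : (0 : ℤ) ≤ adjPairs H Y Y := Nat.cast_nonneg _
    have h4 : (b : ℤ) * X.card ≤ b * (2 * Y.card) := by linarith
    have h5 := le_of_mul_le_mul_left h4 (by exact_mod_cast hb)
    exact_mod_cast h5
  have hdeg : ∀ v ∉ X, (X.filter fun x => H.Adj v x).card ≤ 2 * b := by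
    intro v hv
    have h1 := hmax (insert v X) (by simpa using hYX.trans (Finset.subset_insert v X))
    have h2 : adjPairs H (insert v X) (insert v X) =
        adjPairs H X X + 2 * (X.filter fun x => H.Adj v x).card := by
      simp only [adjPairs_eq, Finset.sum_insert hv, Finset.sum_add_distrib, SimpleGraph.irrefl,
        if_false, Finset.card_filter, H.adj_comm _ v]
      ring
    rw [h2, Finset.card_insert_of_notMem hv] at h1
    push_cast at h1
    have : ((X.filter fun x => H.Adj v x).card : ℤ) ≤ 2 * b := by linarith
    exact_mod_cast this
  refine ⟨X, ?_, hcard⟩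
  by_contra hcov
  simp only [Covers, not_forall, not_or] at hcov
  obtain ⟨u₀, v₀, huv₀, hu₀, hv₀⟩ := hcov
  obtain ⟨lev, top, htop, htops⟩ := hH
  -- For an uncovered edge at `v` of highest level, the neighbors of `v` outside `X` lie in `top
  -- {v}`. So `v` has at most `3 * b` neighbors, and the edge is low after all.
  obtain ⟨v, hv, hvmax⟩ := Finset.exists_max_image
    (Finset.univ.filter fun v => v ∉ X ∧ ∃ u, u ∉ X ∧ H.Adj v u) (fun v => lev {v})
    ⟨u₀, by simpa using ⟨hu₀, v₀, hv₀, huv₀⟩⟩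
  obtain ⟨-, hvX, u, huX, hvu⟩ := Finset.mem_filter.mp hv
  have hlow : LowEdge H ∅ (3 * b + 1) v u := by
    refine ⟨by simp, by simp, hvu, Nat.lt_succ_of_le ?_⟩
    have hsub : (Finset.univ.filter fun x => x ∉ (∅ : Finset V) ∧ H.Adj x v ∧ H.Adj x u) ⊆
        (X.filter fun x => H.Adj v x) ∪ top {v} := by
      intro x hx
      obtain ⟨-, -, hxv, -⟩ := Finset.mem_filter.mp hx
      by_cases hxX : x ∈ X
      · exact Finset.mem_union_left _ (Finset.mem_filter.mpr ⟨hxX, hxv.symm⟩)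
      · obtain ⟨y, hy, rfl⟩ := htops {v} {x} (connected_induce_singleton v)
          (connected_induce_singleton x) ⟨v, rfl, x, rfl, Or.inr hxv.symm⟩
          (hvmax x (Finset.mem_filter.mpr ⟨Finset.mem_univ _, hxX, v, hvX, hxv⟩))
        exact Finset.mem_union_right _ hy
    have h1 := (Finset.card_le_card hsub).trans (Finset.card_union_le _ _)
    have h2 := hdeg v hvX
    have h3 := htop {v}
    unfold codegree
    refine le_trans (le_of_eq ?_) (h1.trans (by omega))
    congr
  rcases hY v u hlow with h | h
  · exact hvX (hYX h)
  · exact huX (hYX h)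

end Sparse

/-! ### Matchings, gaps and scales -/

section Scales

/-- A chain of sets with fewer than `p` elements is stationary at one of the first `p` steps. -/
theorem exists_subset_of_card_lt {α : Type*} {A : ℕ → Finset α} (hA : Monotone A) {p : ℕ}
    (hp : (A p).card < p) : ∃ j < p, A (j + 1) ⊆ A j := by
  by_contra! hcon
  have : ∀ j ≤ p, j ≤ (A j).card := by
    intro j
    induction j with
    | zero => simp
    | succ j ih =>
      intro hj
      have h1 := Finset.card_lt_card
        (Finset.ssubset_iff_subset_ne.mpr ⟨hA (show j ≤ j + 1 by omega),
          fun h => hcon j hj h.symm.le⟩)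
      have := ih (by omega)
      omega
  have := this p le_rfl
  omega

variable {V : Type u} {H : SimpleGraph V}

/-- A set of pairs whose members have no vertices in common. -/
def IsDisjointPairs (E : Finset (V × V)) : Prop :=
  ∀ e ∈ E, ∀ f ∈ E, ∀ v, (v = e.1 ∨ v = e.2) → (v = f.1 ∨ v = f.2) → e = f

theorem IsDisjointPairs.mono {E E' : Finset (V × V)} (h : IsDisjointPairs E) (hE : E' ⊆ E) :
    IsDisjointPairs E' := fun e he f hf => h e (hE he) f (hE hf)

theorem IsDisjointPairs.card_le {E : Finset (V × V)} (hE : IsDisjointPairs E) {Y : Finset V}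
    (hY : ∀ e ∈ E, e.1 ∈ Y ∨ e.2 ∈ Y) : E.card ≤ Y.card := by
  classical
  refine Finset.card_le_card_of_injOn (fun e => if e.1 ∈ Y then e.1 else e.2) ?_ ?_
  · intro e he
    by_cases h : e.1 ∈ Y
    · simp [h]
    · simpa [h] using (hY e he).resolve_left h
  · intro e he f hf hef
    refine hE e he f hf (if e.1 ∈ Y then e.1 else e.2) ?_ ?_
    · split_ifs <;> simp
    · simp only at hef
      rw [hef]
      split_ifs <;> simp

theorem exists_isDisjointPairs [Fintype V] (F : V → V → Prop) :
    ∃ E : Finset (V × V), IsDisjointPairs E ∧ (∀ e ∈ E, F e.1 e.2) ∧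
      ∃ Y : Finset V, Covers Y F ∧ Y.card ≤ 2 * E.card := by
  classical
  obtain ⟨E, hE, hmax⟩ := Finset.exists_max_image
    (Finset.univ.filter fun E : Finset (V × V) => IsDisjointPairs E ∧ ∀ e ∈ E, F e.1 e.2)
    Finset.card ⟨∅, by simp [IsDisjointPairs]⟩
  obtain ⟨-, hE, hEF⟩ := Finset.mem_filter.mp hE
  refine ⟨E, hE, hEF, E.image Prod.fst ∪ E.image Prod.snd, ?_, ?_⟩
  · intro u v huv
    by_contra hnot
    simp only [not_or] at hnot
    have hfst : ∀ e ∈ E, e.1 ∈ E.image Prod.fst ∪ E.image Prod.snd := fun e he =>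
      Finset.mem_union_left _ (Finset.mem_image_of_mem _ he)
    have hsnd : ∀ e ∈ E, e.2 ∈ E.image Prod.fst ∪ E.image Prod.snd := fun e he =>
      Finset.mem_union_right _ (Finset.mem_image_of_mem _ he)
    have huE : ∀ e ∈ E, ∀ w, (w = e.1 ∨ w = e.2) → ¬ (w = u ∨ w = v) := by
      rintro e he w (rfl | rfl) (h | h)
      · exact hnot.1 (h ▸ hfst e he)
      · exact hnot.2 (h ▸ hfst e he)
      · exact hnot.1 (h ▸ hsnd e he)
      · exact hnot.2 (h ▸ hsnd e he)
    have hnew : (u, v) ∉ E := fun h => huE _ h u (Or.inl rfl) (Or.inl rfl)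
    have := hmax (insert (u, v) E) (Finset.mem_filter.mpr ⟨Finset.mem_univ _, ?_, ?_⟩)
    · rw [Finset.card_insert_of_notMem hnew] at this
      omega
    · intro e he f hf w hwe hwf
      rcases Finset.mem_insert.mp he with rfl | he <;> rcases Finset.mem_insert.mp hf with rfl | hf
      · rfl
      · exact absurd hwe (huE f hf w hwf)
      · exact absurd hwf (huE e he w hwe)
      · exact hE e he f hf w hwe hwf
    · intro e he
      rcases Finset.mem_insert.mp he with rfl | he
      · exact huv
      · exact hEF e he
  · have h1 := Finset.card_union_le (E.image Prod.fst) (E.image Prod.snd)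
    have h2 := Finset.card_image_le (s := E) (f := Prod.fst)
    have h3 := Finset.card_image_le (s := E) (f := Prod.snd)
    omega

/-- The edge `e` has an endpoint in the closed neighborhood of `z`. -/
def IsNear (H : SimpleGraph V) (e : V × V) (z : V) : Prop :=
  (e.1 = z ∨ H.Adj z e.1) ∨ (e.2 = z ∨ H.Adj z e.2)

variable [Fintype V]

theorem IsDisjointPairs.card_le_of_notMem_hubs {E : Finset (V × V)} (hE : IsDisjointPairs E)
    {S : Finset V} {F : V → V → Prop} {h : ℝ} {z : V} (hEF : ∀ e ∈ E, F e.1 e.2)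
    (hnear : ∀ e ∈ E, IsNear H e z) (hzS : z ∉ S) (hz : z ∉ hubs H S F h) : (E.card : ℝ) ≤ h := by
  rw [mem_hubs] at hz
  push Not at hz
  obtain ⟨Y, hY, hYh⟩ := hz hzS
  have : E.card ≤ Y.card := hE.card_le fun e he => hY _ _ ⟨hEF e he, hnear e he⟩
  have : (E.card : ℝ) ≤ Y.card := by exact_mod_cast this
  linarith

/-- Among sufficiently many nested sets of vertices `Z 0 ⊆ Z 1 ⊆ ⋯`, there are two consecutive
ones such that most members of a given matching are not near their difference. -/
theorem HasSmallTops.exists_scale {b : ℕ} (hH : HasSmallTops H b) (hb : 0 < b)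
    {E : Finset (V × V)} (hE : IsDisjointPairs E) {Z : ℕ → Finset V} (hZ : Monotone Z)
    (hcard : 4 * ((b + 1) * (Z (8 * b)).card) ≤ E.card) :
    ∃ i < 8 * b, ∃ E' ⊆ E, E.card ≤ 2 * E'.card ∧
      ∀ e ∈ E', e.1 ∉ Z (8 * b) ∧ e.2 ∉ Z (8 * b) ∧ ∀ z ∈ Z (i + 1), z ∉ Z i → ¬ IsNear H e z := by
  classical
  set L := 8 * b
  set P := richVertices H b (Z L)
  let E₀ := E.filter fun e => ¬ (e.1 ∈ P ∪ Z L ∨ e.2 ∈ P ∪ Z L)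
  let bad : V × V → ℕ → Prop := fun e i => ∃ z ∈ Z (i + 1), z ∉ Z i ∧ IsNear H e z
  have hE₀ : E.card ≤ E₀.card + (b + 1) * (Z L).card := by
    have h1 := Finset.card_filter_add_card_filter_not (s := E)
      (fun e => e.1 ∈ P ∪ Z L ∨ e.2 ∈ P ∪ Z L)
    have h2 : (E.filter fun e => e.1 ∈ P ∪ Z L ∨ e.2 ∈ P ∪ Z L).card ≤ (P ∪ Z L).card :=
      (hE.mono (Finset.filter_subset _ _)).card_le fun e he => (Finset.mem_filter.mp he).2
    have h3 := Finset.card_union_le P (Z L)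
    have h4 : P.card ≤ b * (Z L).card := hH.card_richVertices_le (Z L)
    have h5 : E₀.card = (E.filter fun e => ¬ (e.1 ∈ P ∪ Z L ∨ e.2 ∈ P ∪ Z L)).card := rfl
    have h6 : (b + 1) * (Z L).card = b * (Z L).card + (Z L).card := by ring
    omega
  -- The differences `Z (i + 1) \ Z i` are disjoint, and each endpoint of `e` has at most `b`
  -- neighbors in `Z L`. Averaging over `8 * b` indices then loses a quarter of `E`; another quarter
  -- is lost to `P ∪ Z L`.
  have hfew : ∀ e ∈ E₀, ((Finset.range L).filter (bad e)).card ≤ 2 * b := by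
    intro e he
    have hn := (Finset.mem_filter.mp he).2
    simp only [not_or] at hn
    have hadj : ∀ x, x ∉ P ∪ Z L → ((Z L).filter fun z => H.Adj x z).card ≤ b := by
      intro x hx
      by_contra hlt
      exact hx (Finset.mem_union_left _ (Finset.mem_filter.mpr ⟨Finset.mem_univ _, not_le.mp hlt⟩))
    have hbad : ∀ i, ∃ z, bad e i → z ∈ Z (i + 1) ∧ z ∉ Z i ∧ IsNear H e z := by
      intro i
      by_cases h : bad e i
      · obtain ⟨z, hz⟩ := h
        exact ⟨z, fun _ => hz⟩
      · exact ⟨e.1, fun h' => absurd h' h⟩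
    choose w hw using hbad
    have hle : ((Finset.range L).filter (bad e)).card ≤
        (((Z L).filter fun z => H.Adj e.1 z) ∪ ((Z L).filter fun z => H.Adj e.2 z)).card := by
      refine Finset.card_le_card_of_injOn w ?_ ?_
      · intro i hi
        obtain ⟨hiL, hi⟩ := Finset.mem_filter.mp hi
        obtain ⟨h1, -, h3⟩ := hw i hi
        have hwL : w i ∈ Z L := hZ (Finset.mem_range.mp hiL) h1
        rcases h3 with (h3 | h3) | (h3 | h3)
        · exact absurd (Finset.mem_union_right _ (h3 ▸ hwL)) hn.1
        · exact Finset.mem_union_left _ (Finset.mem_filter.mpr ⟨hwL, h3.symm⟩)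
        · exact absurd (Finset.mem_union_right _ (h3 ▸ hwL)) hn.2
        · exact Finset.mem_union_right _ (Finset.mem_filter.mpr ⟨hwL, h3.symm⟩)
      · intro i hi j hj hij
        obtain ⟨hi1, hi2, -⟩ := hw i (Finset.mem_filter.mp hi).2
        obtain ⟨hj1, hj2, -⟩ := hw j (Finset.mem_filter.mp hj).2
        by_contra hne
        rcases lt_or_gt_of_ne hne with hlt | hlt
        · exact hj2 (hZ (Nat.succ_le_of_lt hlt) (hij ▸ hi1))
        · exact hi2 (hZ (Nat.succ_le_of_lt hlt) (hij ▸ hj1))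
    have := Finset.card_union_le ((Z L).filter fun z => H.Adj e.1 z)
      ((Z L).filter fun z => H.Adj e.2 z)
    have := hadj e.1 hn.1
    have := hadj e.2 hn.2
    omega
  have hsum : ∑ i ∈ Finset.range L, (E₀.filter fun e => bad e i).card ≤ 2 * b * E.card := by
    have : ∑ i ∈ Finset.range L, (E₀.filter fun e => bad e i).card =
        ∑ e ∈ E₀, ((Finset.range L).filter (bad e)).card := by
      simp only [Finset.card_filter]
      exact Finset.sum_comm
    rw [this]
    refine (Finset.sum_le_card_nsmul _ _ _ hfew).trans ?_
    rw [smul_eq_mul, mul_comm]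
    exact Nat.mul_le_mul_left _ (Finset.card_le_card (Finset.filter_subset _ _))
  obtain ⟨i, hiL, hi⟩ : ∃ i < L, 4 * (E₀.filter fun e => bad e i).card ≤ E.card := by
    by_contra! hcon
    have h1 : L * (E.card + 1) ≤ ∑ i ∈ Finset.range L, 4 * (E₀.filter fun e => bad e i).card := by
      have := Finset.card_nsmul_le_sum (Finset.range L)
        (fun i => 4 * (E₀.filter fun e => bad e i).card) (E.card + 1)
        (fun i hi => hcon i (Finset.mem_range.mp hi))
      simpa using this
    rw [← Finset.mul_sum] at h1
    have h2 : L * (E.card + 1) ≤ L * E.card := by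
      calc L * (E.card + 1) ≤ 4 * (2 * b * E.card) := h1.trans (Nat.mul_le_mul_left 4 hsum)
        _ = L * E.card := by simp only [L]; ring
    have h3 := Nat.le_of_mul_le_mul_left h2 (by omega)
    omega
  refine ⟨i, hiL, E₀.filter fun e => ¬ bad e i,
    (Finset.filter_subset _ _).trans (Finset.filter_subset _ _), ?_, ?_⟩
  · have := Finset.card_filter_add_card_filter_not (s := E₀) (fun e => bad e i)
    omega
  · intro e he
    obtain ⟨he, hbad⟩ := Finset.mem_filter.mp he
    have hn := (Finset.mem_filter.mp he).2
    simp only [not_or, Finset.mem_union] at hn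
    exact ⟨hn.1.2, hn.2.2, fun z hz hz' hnear => hbad ⟨z, hz, hz', hnear⟩⟩

/-- Hub sizes have a gap of size proportional to `n` below any given scale. -/
theorem exists_hubs_gap {S : Finset V} {F : V → V → Prop} {ε n : ℝ} {p : ℕ} (hεn : 0 ≤ ε * n)
    (hp : (hubs H S F (ε / 2 * n)).card < p) :
    ∃ h, ε / 2 * n ≤ h ∧ h ≤ ε * n ∧ hubs H S F (h - ε / (2 * p) * n) ⊆ hubs H S F h := by
  have hp0 : (0 : ℝ) < p := by exact_mod_cast (Nat.zero_le _).trans_lt hp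
  have hγ : 0 ≤ ε / (2 * p) * n := by
    rw [div_mul_eq_mul_div]
    positivity
  have hpγ : (p : ℝ) * (ε / (2 * p) * n) = ε / 2 * n := by field_simp
  -- The interval from `ε / 2 * n` to `ε * n` is cut into `p` steps; the last set has fewer than `p`
  -- elements, so some step adds no hub.
  let A : ℕ → Finset V := fun j => hubs H S F (ε * n - j * (ε / (2 * p) * n))
  have hA : Monotone A := by
    intro i j hij
    have : (i : ℝ) ≤ j := by exact_mod_cast hij
    refine hubs_anti ?_
    have := mul_le_mul_of_nonneg_right this hγ
    linarith
  have hAp : A p = hubs H S F (ε / 2 * n) := by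
    simp only [A, hpγ]
    congr 1
    ring
  obtain ⟨j, hj, hsub⟩ := exists_subset_of_card_lt hA (p := p) (by rw [hAp]; exact hp)
  have hjp : (j : ℝ) ≤ p := by exact_mod_cast hj.le
  have h1 := mul_le_mul_of_nonneg_right hjp hγ
  have h2 : 0 ≤ (j : ℝ) * (ε / (2 * p) * n) := by positivity
  refine ⟨ε * n - j * (ε / (2 * p) * n), by linarith, by linarith, ?_⟩
  refine Finset.Subset.trans (Finset.Subset.trans ?_ hsub) (Finset.Subset.refl _)
  refine hubs_anti (le_of_eq ?_)
  push_cast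
  ring

end Scales

/-! ### The induction -/

section Induction

variable {V : Type u} {H : SimpleGraph V}

open scoped Classical in
/-- The weight used after the edges covered by `Y` have been taken into account. -/
noncomputable def averageWeight (μ : V → ℝ) (Y : Finset V) (v : V) : ℝ :=
  (μ v + (if v ∈ Y then (1 : ℝ) else 0) / Y.card) / 2

theorem averageWeight_nonneg {μ : V → ℝ} (hμ : ∀ v, 0 ≤ μ v) (Y : Finset V) (v : V) :
    0 ≤ averageWeight μ Y v := by
  have := hμ v
  unfold averageWeight
  split_ifs <;> positivity

open scoped Classical in
theorem sum_averageWeight (μ : V → ℝ) (Y A : Finset V) :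
    ∑ v ∈ A, averageWeight μ Y v = (∑ v ∈ A, μ v + ((Y ∩ A).card : ℝ) / Y.card) / 2 := by
  unfold averageWeight
  rw [← Finset.sum_div, Finset.sum_add_distrib, ← Finset.sum_div]
  congr 3
  rw [Finset.sum_ite_mem, Finset.sum_const, nsmul_eq_mul, mul_one, Finset.inter_comm]

variable [Fintype V]

/-- The set `S` is protected with respect to all `M` whose closed neighborhood in `H - S` has
weight at most `η`. -/
def IsProtectedUpTo (H : SimpleGraph V) (S : Finset V) (μ : V → ℝ) (η : ℝ) : Prop :=
  ∀ M, Disjoint M S → ∑ v ∈ closedNbhd H S M, μ v ≤ η → IsProtected H S M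

/-- A large family of scattered edges contains a matching gadget. -/
theorem exists_isMatchingGadget_of_pairwiseDisjoint {S Y : Finset V} {μ : V → ℝ} {η : ℝ}
    {k t q : ℕ} (hη : 0 < η) (hμ : ∀ v, 0 ≤ μ v) (hμ1 : ∑ v, μ v ≤ 1)
    (hS : IsProtectedUpTo H S μ η) (hY : Covers Y (LowEdge H S t)) (hq : (k : ℝ) ≤ η * q)
    {E : Finset (V × V)} (hE : ∀ e ∈ E, e.1 ∉ S ∧ e.2 ∉ S ∧ H.Adj e.1 e.2 ∧
      codegree H S e.1 e.2 ≤ t)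
    (hdisj : ∀ e ∈ E, ∀ f ∈ E, ∀ v ∉ S, IsNear H e v → IsNear H f v → e = f)
    (hcard : Y.card + q + k ≤ E.card) : ∃ M : Set V, IsMatchingGadget H k M := by
  classical
  let N : V × V → Finset V := fun e => Finset.univ.filter fun v => v ∉ S ∧ IsNear H e v
  have hN : ∀ e v, v ∈ N e ↔ v ∉ S ∧ IsNear H e v := fun e v => by simp [N]
  have hdisjN : ∀ E' ⊆ E, (E' : Set (V × V)).PairwiseDisjoint N := by
    intro E' hE' e he f hf hef
    rw [Function.onFun, Finset.disjoint_left]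
    intro v hv hv'
    exact hef (hdisj e (hE' he) f (hE' hf) v ((hN e v).mp hv).1 ((hN e v).mp hv).2
      ((hN f v).mp hv').2)
  have hbad1 : (E.filter fun e => ¬ Disjoint Y (N e)).card ≤ Y.card := by
    have hex : ∀ e : V × V, ∃ y, ¬ Disjoint Y (N e) → y ∈ Y ∧ y ∈ N e := by
      intro e
      by_cases h : Disjoint Y (N e)
      · exact ⟨e.1, fun h' => absurd h h'⟩
      · obtain ⟨y, hy⟩ := Finset.not_disjoint_iff.mp h
        exact ⟨y, fun _ => hy⟩
    choose g hg using hex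
    refine Finset.card_le_card_of_injOn g (fun e he => (hg e (Finset.mem_filter.mp he).2).1) ?_
    intro e he f hf hef
    obtain ⟨he, he'⟩ := Finset.mem_filter.mp he
    obtain ⟨hf, hf'⟩ := Finset.mem_filter.mp hf
    have h1 := (hN e _).mp (hg e he').2
    have h2 := (hN f _).mp (hg f hf').2
    exact hdisj e he f hf (g e) h1.1 h1.2 (hef ▸ h2.2)
  -- The neighborhoods are disjoint and the total weight is at most 1, so few of them weigh more
  -- than `η / k`.
  have hbad2 : (E.filter fun e => η < k * ∑ v ∈ N e, μ v).card ≤ q := by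
    set B := E.filter fun e => η < k * ∑ v ∈ N e, μ v
    have h1 : η * B.card ≤ k * ∑ e ∈ B, ∑ v ∈ N e, μ v := by
      rw [Finset.mul_sum, mul_comm, ← nsmul_eq_mul]
      exact Finset.card_nsmul_le_sum _ _ _ fun e he => (Finset.mem_filter.mp he).2.le
    have h2 : ∑ e ∈ B, ∑ v ∈ N e, μ v ≤ 1 := by
      rw [← Finset.sum_biUnion (hdisjN B (Finset.filter_subset _ _))]
      exact (Finset.sum_le_sum_of_subset_of_nonneg (Finset.subset_univ _)
        fun v _ _ => hμ v).trans hμ1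
    have h3 : (k : ℝ) * ∑ e ∈ B, ∑ v ∈ N e, μ v ≤ k * 1 :=
      mul_le_mul_of_nonneg_left h2 (Nat.cast_nonneg k)
    have h4 : η * (B.card : ℝ) ≤ η * q := by linarith
    exact_mod_cast le_of_mul_le_mul_left h4 hη
  obtain ⟨E', hE'sub, hE'card⟩ : ∃ E' ⊆ E.filter (fun e => Disjoint Y (N e) ∧
      k * ∑ v ∈ N e, μ v ≤ η), E'.card = k := by
    refine Finset.exists_subset_card_eq ?_
    have hsub : E ⊆ E.filter (fun e => ¬ Disjoint Y (N e)) ∪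
        E.filter (fun e => η < k * ∑ v ∈ N e, μ v) ∪
        E.filter (fun e => Disjoint Y (N e) ∧ k * ∑ v ∈ N e, μ v ≤ η) := by
      intro e he
      simp only [Finset.mem_union, Finset.mem_filter, he, true_and]
      by_cases h1 : Disjoint Y (N e)
      · rcases le_or_gt (k * ∑ v ∈ N e, μ v) η with h2 | h2
        · exact Or.inr ⟨h1, h2⟩
        · exact Or.inl (Or.inr h2)
      · exact Or.inl (Or.inl h1)
    have h1 := Finset.card_le_card hsub
    have h2 := Finset.card_union_le (E.filter (fun e => ¬ Disjoint Y (N e)) ∪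
        E.filter (fun e => η < k * ∑ v ∈ N e, μ v))
        (E.filter (fun e => Disjoint Y (N e) ∧ k * ∑ v ∈ N e, μ v ≤ η))
    have h3 := Finset.card_union_le (E.filter (fun e => ¬ Disjoint Y (N e)))
        (E.filter (fun e => η < k * ∑ v ∈ N e, μ v))
    omega
  have hE'E : E' ⊆ E := hE'sub.trans (Finset.filter_subset _ _)
  let g : Fin k ≃ E' := (E'.equivFinOfCardEq hE'card).symm
  let a : Fin k → V := fun i => (g i).1.1
  let b : Fin k → V := fun i => (g i).1.2
  have hg : ∀ i, (g i).1 ∈ E := fun i => hE'E (g i).2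
  have hsc : IsScattered H S a b := by
    refine ⟨fun i => (hE _ (hg i)).2.2.1, fun i => (hE _ (hg i)).1, fun i => (hE _ (hg i)).2.1, ?_⟩
    intro i j v hv hi hj
    have hnear : ∀ i, (v = a i ∨ v = b i ∨ H.Adj v (a i) ∨ H.Adj v (b i)) →
        IsNear H (g i).1 v := by
      rintro i (h | h | h | h)
      · exact Or.inl (Or.inl h.symm)
      · exact Or.inr (Or.inl h.symm)
      · exact Or.inl (Or.inr h)
      · exact Or.inr (Or.inr h)
    exact g.injective (Subtype.ext (hdisj _ (hg i) _ (hg j) v hv (hnear i hi) (hnear j hj)))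
  have hclosed : ∀ v ∈ closedNbhd H S (endpoints a b), ∃ i, v ∈ N (g i).1 := by
    intro v hv
    obtain ⟨hvS, hv⟩ := mem_closedNbhd.mp hv
    rcases hv with hv | ⟨m, hm, hmv⟩
    · obtain ⟨i, h | h⟩ := mem_endpoints.mp hv
      · exact ⟨i, (hN _ _).mpr ⟨hvS, Or.inl (Or.inl h.symm)⟩⟩
      · exact ⟨i, (hN _ _).mpr ⟨hvS, Or.inr (Or.inl h.symm)⟩⟩
    · obtain ⟨i, rfl | rfl⟩ := mem_endpoints.mp hm
      · exact ⟨i, (hN _ _).mpr ⟨hvS, Or.inl (Or.inr hmv.symm)⟩⟩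
      · exact ⟨i, (hN _ _).mpr ⟨hvS, Or.inr (Or.inr hmv.symm)⟩⟩
  have hsel : ∀ i, Disjoint Y (N (g i).1) ∧ k * ∑ v ∈ N (g i).1, μ v ≤ η := fun i =>
    (Finset.mem_filter.mp (hE'sub (g i).2)).2
  have hweight : ∑ v ∈ closedNbhd H S (endpoints a b), μ v ≤ η := by
    have h1 : ∑ v ∈ closedNbhd H S (endpoints a b), μ v ≤ ∑ i, ∑ v ∈ N (g i).1, μ v := by
      refine le_trans (Finset.sum_le_sum_of_subset_of_nonneg (t := E'.biUnion N) ?_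
        fun v _ _ => hμ v) ?_
      · intro v hv
        obtain ⟨i, hi⟩ := hclosed v hv
        exact Finset.mem_biUnion.mpr ⟨_, (g i).2, hi⟩
      · rw [Finset.sum_biUnion (hdisjN E' hE'E), ← Finset.sum_coe_sort]
        exact (Equiv.sum_comp g fun e : E' => ∑ v ∈ N e.1, μ v).ge
    refine h1.trans ?_
    rcases Nat.eq_zero_or_pos k with rfl | hk
    · simpa using hη.le
    · have hk' : (0 : ℝ) < k := by exact_mod_cast hk
      refine (Finset.sum_le_card_nsmul _ _ (η / k) fun i _ => ?_).trans (le_of_eq ?_)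
      · rw [le_div_iff₀ hk', mul_comm]
        exact (hsel i).2
      · rw [Finset.card_univ, Fintype.card_fin, nsmul_eq_mul]
        field_simp
  refine ⟨_, isMatchingGadget_of_isScattered hsc (fun i => (hE _ (hg i)).2.2.2)
    (hS _ hsc.disjoint hweight) hY ?_⟩
  rw [Finset.disjoint_right]
  intro v hv hvY
  obtain ⟨i, hi⟩ := hclosed v hv
  exact Finset.disjoint_left.mp (hsel i).1 hvY hi

open scoped Classical in
-- The new weight averages the old one with the uniform weight on `Y`, so being light for it bounds
-- both the old weight and the share of `Y`. Passing back from `S ∪ Z` to `S` adds only the few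
-- hubs, which are negligible in both respects.
theorem IsProtectedUpTo.union_hubs {S Y : Finset V} {μ : V → ℝ} {η η' h γ : ℝ} {t p N : ℕ}
    (hS : IsProtectedUpTo H S μ η) (hμ : ∀ v, 0 ≤ μ v) (hμN : ∀ v, μ v * N ≤ 1)
    (hY : Covers Y (LowEdge H S t)) (hYpos : 0 < Y.card)
    (hgap : hubs H S (LowEdge H S t) (h - γ * Y.card) ⊆ hubs H S (LowEdge H S t) h)
    (hp : (hubs H S (LowEdge H S t) h).card ≤ p) (hη' : 4 * η' ≤ η) (hγ' : 4 * η' ≤ γ)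
    (hNpos : 0 < N) (hN : 2 * p ≤ η * N) (hn : 2 * p ≤ γ * Y.card) :
    IsProtectedUpTo H (S ∪ hubs H S (LowEdge H S t) h) (averageWeight μ Y) η' := by
  intro M hM hweight
  set Z := hubs H S (LowEdge H S t) h
  have hYpos' : (0 : ℝ) < Y.card := by exact_mod_cast hYpos
  have hNpos' : (0 : ℝ) < N := by exact_mod_cast hNpos
  have hpZ : (Z.card : ℝ) ≤ p := by exact_mod_cast hp
  have hsub : closedNbhd H S M ⊆ closedNbhd H (S ∪ Z) M ∪ Z := by
    intro v hv
    obtain ⟨hvS, hv⟩ := mem_closedNbhd.mp hv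
    by_cases hvZ : v ∈ Z
    · exact Finset.mem_union_right _ hvZ
    · refine Finset.mem_union_left _ (mem_closedNbhd.mpr ⟨?_, hv⟩)
      simp [hvS, hvZ]
  rw [sum_averageWeight] at hweight
  have hμsum : 0 ≤ ∑ v ∈ closedNbhd H (S ∪ Z) M, μ v := Finset.sum_nonneg fun v _ => hμ v
  have hcnn : 0 ≤ ((Y ∩ closedNbhd H (S ∪ Z) M).card : ℝ) / Y.card := by positivity
  have hcY : ((Y ∩ closedNbhd H (S ∪ Z) M).card : ℝ) ≤ 2 * η' * Y.card := by
    rw [← div_le_iff₀ hYpos']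
    linarith
  have hMS : Disjoint M S := hM.mono_right Finset.subset_union_left
  refine IsProtected.union_hubs (c := γ * Y.card) (hS M hMS ?_) hM hY hgap ?_
  · have h1 : ∑ v ∈ closedNbhd H S M, μ v ≤
        ∑ v ∈ closedNbhd H (S ∪ Z) M, μ v + ∑ v ∈ Z, μ v := by
      refine (Finset.sum_le_sum_of_subset_of_nonneg hsub fun v _ _ => hμ v).trans ?_
      rw [← Finset.sum_union_inter]
      have : 0 ≤ ∑ v ∈ closedNbhd H (S ∪ Z) M ∩ Z, μ v := Finset.sum_nonneg fun v _ => hμ v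
      linarith
    have h2 : ∑ v ∈ Z, μ v ≤ p / N := by
      refine (Finset.sum_le_card_nsmul Z _ (1 / (N : ℝ)) fun v _ => ?_).trans ?_
      · rw [le_div_iff₀ hNpos']
        exact hμN v
      · rw [nsmul_eq_mul, mul_one_div]
        exact div_le_div_of_nonneg_right hpZ hNpos'.le
    have h3 : (p : ℝ) / N ≤ η / 2 := by
      rw [div_le_iff₀ hNpos']
      linarith
    linarith
  · have h1 : ((Y ∩ closedNbhd H S M).card : ℝ) ≤ (Y ∩ closedNbhd H (S ∪ Z) M).card + Z.card := by
      have h2 : Y ∩ closedNbhd H S M ⊆ (Y ∩ closedNbhd H (S ∪ Z) M) ∪ Z := by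
        intro v hv
        obtain ⟨hvY, hv⟩ := Finset.mem_inter.mp hv
        rcases Finset.mem_union.mp (hsub hv) with h | h
        · exact Finset.mem_union_left _ (Finset.mem_inter.mpr ⟨hvY, h⟩)
        · exact Finset.mem_union_right _ h
      exact_mod_cast (Finset.card_le_card h2).trans (Finset.card_union_le _ _)
    have h2 : 4 * η' * Y.card ≤ γ * Y.card := mul_le_mul_of_nonneg_right hγ' hYpos'.le
    linarith

end Induction

/-! ### Induction on the number of triangles -/

section Main

theorem codegree_anti {V : Type u} [Fintype V] {H : SimpleGraph V} {S S' : Finset V} (h : S ⊆ S')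
    (u v : V) : codegree H S' u v ≤ codegree H S u v := by
  unfold codegree
  refine Finset.card_le_card fun x hx => ?_
  simp only [Finset.mem_filter, Finset.mem_univ, true_and] at hx ⊢
  exact ⟨fun hxS => hx.1 (h hxS), hx.2⟩

/-- With parameter `N`, a set `S` protected up to weight `η` suffices for a gadget as soon as the
edges of `H - S` in fewer than `t` triangles have no cover with fewer than `N` vertices. -/
def GadgetBound (b k t : ℕ) (η : ℝ) (N : ℕ) : Prop :=
  ∀ (V : Type u) [Fintype V] (H : SimpleGraph V) (S : Finset V) (μ : V → ℝ), HasSmallTops H b →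
    (∀ v, 0 ≤ μ v) → ∑ v, μ v ≤ 1 → (∀ v, μ v * N ≤ 1) → IsProtectedUpTo H S μ η →
    (∀ Y, Covers Y (LowEdge H S t) → N ≤ Y.card) → ∃ M : Set V, IsMatchingGadget H k M

theorem gadgetBound_zero (b k : ℕ) (η : ℝ) : GadgetBound.{u} b k 0 η 1 := by
  intro V _ H S μ _ _ _ _ _ hcov
  have := hcov ∅ fun u v huv => absurd huv.2.2.2 (Nat.not_lt_zero _)
  simp at this

/-- The order of choice matters: `p` bounds the hubs at scale `ε / 2`, `η'` is the next weight
threshold, `R` comes from the induction hypothesis at `η'`, `q` bounds the heavy edges, and only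
then is the next scale `ε'` made small enough to give `R + q + k` disjoint neighborhoods. -/
theorem exists_scale_constants {b k t : ℕ} (hb : 0 < b)
    (ih : ∀ η > 0, ∃ N, GadgetBound.{u} b k t η N) {η : ℝ} (hη : 0 < η) {ε : ℝ} (hε : 0 < ε) :
    ∃ (p R q : ℕ) (η' ε' : ℝ), 0 < p ∧ 2 * (b + b * b + 1 : ℝ) ≤ ε / 2 * p ∧ 0 < η' ∧
      4 * η' ≤ η ∧ 4 * η' ≤ ε / (2 * p) ∧ GadgetBound.{u} b k t η' R ∧ (k : ℝ) ≤ η' * q ∧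
      0 < ε' ∧ ε' ≤ ε / 2 ∧ 4 * b * ε' * (R + q + k : ℕ) ≤ 1 := by
  obtain ⟨p, hp⟩ := exists_nat_ge (2 * (b + b * b + 1 : ℝ) / (ε / 2))
  have hp' : 2 * (b + b * b + 1 : ℝ) ≤ ε / 2 * p := by
    rw [div_le_iff₀ (by positivity)] at hp
    linarith
  have hp0 : 0 < p := by
    rcases Nat.eq_zero_or_pos p with rfl | h
    · have : (0 : ℝ) < 2 * (b + b * b + 1) := by positivity
      simp only [Nat.cast_zero, mul_zero] at hp'
      linarith
    · exact h
  have hp0' : (0 : ℝ) < p := by exact_mod_cast hp0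
  have hη' : 0 < min η (ε / (2 * p)) / 4 := by positivity
  obtain ⟨R, hR⟩ := ih _ hη'
  obtain ⟨q, hq⟩ := exists_nat_ge ((k : ℝ) / (min η (ε / (2 * p)) / 4))
  rw [div_le_iff₀ hη', mul_comm] at hq
  have hb' : (0 : ℝ) < b := by exact_mod_cast hb
  have h1 := min_le_left η (ε / (2 * p))
  have h2 := min_le_right η (ε / (2 * p))
  refine ⟨p, R, q, _, min (ε / 2) (1 / (4 * b * ((R + q + k : ℕ) + 1))), hp0, hp', hη', by linarith,
    by linarith, hR, hq, by positivity, min_le_left _ _, ?_⟩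
  have h3 := min_le_right (ε / 2) (1 / (4 * b * (((R + q + k : ℕ) : ℝ) + 1)))
  have h4 : (0 : ℝ) < 4 * b * (((R + q + k : ℕ) : ℝ) + 1) := by positivity
  rw [le_div_iff₀ h4] at h3
  have h5 : 0 < min (ε / 2) (1 / (4 * b * (((R + q + k : ℕ) : ℝ) + 1))) := by positivity
  nlinarith [mul_pos hb' h5]

theorem exists_gadgetBound_succ {b k t : ℕ} (hb : 0 < b)
    (ih : ∀ η > 0, ∃ N, GadgetBound.{u} b k t η N) {η : ℝ} (hη : 0 < η) :
    ∃ N, GadgetBound.{u} b k (t + 1) η N := by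
  classical
  have hdata := fun (ε : ℝ) (hε : 0 < ε) => exists_scale_constants hb ih hη hε
  choose! p R q η' next hp0 hp hη'0 hη' hγ hR hq hnext0 hnext hm using hdata
  let s : ℕ → ℝ := fun i => next^[i] 1
  have hs_succ : ∀ i, s (i + 1) = next (s i) := fun i => Function.iterate_succ_apply' _ _ _
  have hs0 : ∀ i, 0 < s i := by
    intro i
    induction i with
    | zero => exact one_pos
    | succ i ih => rw [hs_succ]; exact hnext0 _ ih
  have hs_half : ∀ i, s (i + 1) ≤ s i / 2 := fun i => by rw [hs_succ]; exact hnext _ (hs0 i)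
  have hs_anti : Antitone s := antitone_nat_of_succ_le fun i => by
    have := hs_half i
    have := hs0 i
    linarith
  have hbound : ∀ i, ∃ K : ℕ, (b + 1) * (p (s i) * p (s i)) + b * p (s i) < K ∧ R (s i) ≤ K ∧
      2 * (p (s i) : ℝ) ≤ η * K ∧ 2 * (p (s i) : ℝ) ≤ s i / (2 * p (s i)) * K ∧
      8 * ((b + 1) * p (s i)) ≤ K := by
    intro i
    have hpi : (0 : ℝ) < p (s i) := by exact_mod_cast hp0 _ (hs0 i)
    have hγi : 0 < s i / (2 * p (s i)) := by have := hs0 i; positivity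
    obtain ⟨K₁, hK₁⟩ := exists_nat_ge (2 * (p (s i) : ℝ) / η)
    obtain ⟨K₂, hK₂⟩ := exists_nat_ge (2 * (p (s i) : ℝ) / (s i / (2 * p (s i))))
    rw [div_le_iff₀ hη] at hK₁
    rw [div_le_iff₀ hγi] at hK₂
    refine ⟨((b + 1) * (p (s i) * p (s i)) + b * p (s i) + 1) + R (s i) + K₁ + K₂ +
      8 * ((b + 1) * p (s i)), by omega, by omega, ?_, ?_, by omega⟩
    · refine hK₁.trans ?_
      rw [mul_comm]
      refine mul_le_mul_of_nonneg_left ?_ hη.le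
      exact_mod_cast (by omega)
    · refine hK₂.trans ?_
      rw [mul_comm]
      refine mul_le_mul_of_nonneg_left ?_ hγi.le
      exact_mod_cast (by omega)
  choose K hK1 hK2 hK3 hK4 hK5 using hbound
  -- The scale `i` depends on the graph, so the bound must serve all scales at once.
  refine ⟨∑ i ∈ Finset.range (8 * b + 1), K i, ?_⟩
  set N := ∑ i ∈ Finset.range (8 * b + 1), K i
  have hKN : ∀ i ≤ 8 * b, K i ≤ N := fun i hi =>
    Finset.single_le_sum (f := K) (fun _ _ => Nat.zero_le _) (Finset.mem_range.mpr (by omega))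
  intro V _ H S μ hH hμ hμ1 hμN hS hcov
  set F := LowEdge H S (t + 1)
  have hF : ∀ u v, F u v → H.Adj u v := fun u v h => h.2.2.1
  obtain ⟨Y, hYmem, hYmin⟩ := Finset.exists_min_image
    (Finset.univ.filter fun Y : Finset V => Covers Y F) Finset.card
    ⟨Finset.univ, Finset.mem_filter.mpr
      ⟨Finset.mem_univ _, fun u _ _ => Or.inl (Finset.mem_univ u)⟩⟩
  have hY : Covers Y F := (Finset.mem_filter.mp hYmem).2
  have hNn : N ≤ Y.card := hcov Y hY
  obtain ⟨E, hE, hEF, Y₁, hY₁, hY₁E⟩ := exists_isDisjointPairs F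
  have hnE : Y.card ≤ 2 * E.card := (hYmin Y₁ (by simpa using hY₁)).trans hY₁E
  let n : ℝ := Y.card
  have hNn' : (N : ℝ) ≤ n := Nat.cast_le.mpr hNn
  have hNpos : 0 < N := lt_of_lt_of_le (Nat.zero_lt_of_lt (hK1 0)) (hKN 0 (Nat.zero_le _))
  have hn0 : 0 < Y.card := lt_of_lt_of_le hNpos hNn
  have hn0' : 0 < n := Nat.cast_pos.mpr hn0
  let Z : ℕ → Finset V := fun i => hubs H S F (s i * n)
  have hZ : Monotone Z := fun i j hij =>
    hubs_anti (mul_le_mul_of_nonneg_right (hs_anti hij) hn0'.le)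
  have hhubs : ∀ i ≤ 8 * b, (hubs H S F (s i / 2 * n)).card < p (s i) := fun i hi =>
    hH.card_hubs_lt hF hY (hp _ (hs0 i)) (lt_of_lt_of_le (hK1 i) ((hKN i hi).trans hNn))
  obtain ⟨i, hiL, E', hE'E, hE'card, hE'⟩ := hH.exists_scale hb hE hZ (by
    have h1 : (Z (8 * b)).card ≤ p (s (8 * b)) := by
      refine le_trans (Finset.card_le_card (hubs_anti ?_)) (hhubs (8 * b) le_rfl).le
      have := hs0 (8 * b)
      nlinarith
    have h2 := (hK5 (8 * b)).trans ((hKN _ le_rfl).trans hNn)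
    have h3 := Nat.mul_le_mul_left (b + 1) h1
    omega)
  have hi := hs0 i
  obtain ⟨h, hh1, hh2, hgap⟩ := exists_hubs_gap (H := H) (mul_nonneg hi.le hn0'.le)
    (hhubs i hiL.le)
  set S' := S ∪ hubs H S F h with hS'def
  have hSS' : S ⊆ S' := Finset.subset_union_left
  have hhub : (hubs H S F h).card ≤ p (s i) :=
    (Finset.card_le_card (hubs_anti hh1)).trans (hhubs i hiL.le).le
  have hKn : (K i : ℝ) ≤ N := by exact_mod_cast hKN i hiL.le
  have hpi : (0 : ℝ) < p (s i) := by exact_mod_cast hp0 _ hi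
  have hprot : IsProtectedUpTo H S' (averageWeight μ Y) (η' (s i)) := by
    refine hS.union_hubs hμ hμN hY hn0 hgap hhub (hη' _ hi) (hγ _ hi) hNpos ?_ ?_
    · exact (hK3 i).trans (mul_le_mul_of_nonneg_left hKn hη.le)
    · exact (hK4 i).trans (mul_le_mul_of_nonneg_left (hKn.trans hNn') (by positivity))
  have hμ' := averageWeight_nonneg hμ Y
  have hμ'1 : ∑ v, averageWeight μ Y v ≤ 1 := by
    rw [sum_averageWeight, Finset.inter_univ, div_self hn0'.ne']
    linarith
  -- Either the induction hypothesis applies to `S'`, or the edges in fewer than `t` triangles of `H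
  -- - S'` have a small cover and the gadget is built from `E'`.
  by_cases hbig : ∀ Y' : Finset V, Covers Y' (LowEdge H S' t) → R (s i) ≤ Y'.card
  · refine hR _ hi V H S' _ hH hμ' hμ'1 (fun v => ?_) hprot hbig
    have hRN : (R (s i) : ℝ) ≤ N := le_trans (by exact_mod_cast hK2 i) hKn
    have h1 : μ v * R (s i) ≤ 1 := (mul_le_mul_of_nonneg_left hRN (hμ v)).trans (hμN v)
    have h2 : (if v ∈ Y then (1 : ℝ) else 0) / n * R (s i) ≤ 1 := by
      rw [div_mul_eq_mul_div, div_le_one hn0']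
      split_ifs
      · linarith
      · linarith
    have h3 : averageWeight μ Y v = (μ v + (if v ∈ Y then (1 : ℝ) else 0) / n) / 2 := by
      unfold averageWeight
      congr
    rw [h3]
    linarith
  · push Not at hbig
    obtain ⟨Y', hY', hY'R⟩ := hbig
    have hE'F : ∀ e ∈ E', F e.1 e.2 := fun e he => hEF e (hE'E he)
    have hhZ : hubs H S F h ⊆ Z (8 * b) := by
      refine hubs_anti ?_
      have h1 : s (8 * b) ≤ s i / 2 := (hs_anti (Nat.succ_le_of_lt hiL)).trans (hs_half i)
      exact (mul_le_mul_of_nonneg_right h1 hn0'.le).trans hh1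
    have hE'S : ∀ e ∈ E', e.1 ∉ S' ∧ e.2 ∉ S' := by
      intro e he
      obtain ⟨h1, h2, -⟩ := hE' e he
      have hlow := hE'F e he
      simp only [hS'def, Finset.mem_union, not_or]
      exact ⟨⟨hlow.1, fun h' => h1 (hhZ h')⟩, ⟨hlow.2.1, fun h' => h2 (hhZ h')⟩⟩
    let N' : V × V → Finset V := fun e => closedNbhd H S' {e.1, e.2}
    have hN' : ∀ e v, v ∈ N' e ↔ v ∉ S' ∧ IsNear H e v := by
      intro e v
      simp only [N', mem_closedNbhd, IsNear, Finset.mem_insert, Finset.mem_singleton,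
        exists_eq_or_imp, exists_eq_left, eq_comm (a := e.1) (b := v), eq_comm (a := e.2) (b := v),
        H.adj_comm v]
      tauto
    obtain ⟨D, hDE, hD, hDcard⟩ := hH.exists_pairwiseDisjoint E' N' (q := s (i + 1) * n)
      (fun e he => connected_induce_doubleStar (c := e.1) (d := e.2)
        ((hN' e _).mpr ⟨(hE'S e he).1, Or.inl (Or.inl rfl)⟩)
        ((hN' e _).mpr ⟨(hE'S e he).2, Or.inr (Or.inl rfl)⟩) (hF _ _ (hE'F e he))
        (fun x hx => by
          rcases ((hN' e x).mp hx).2 with (h' | h') | (h' | h')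
          · exact Or.inl h'.symm
          · exact Or.inr (Or.inr (Or.inl h'.symm))
          · exact Or.inr (Or.inl h'.symm)
          · exact Or.inr (Or.inr (Or.inr h'.symm))))
      (fun x => by
        have hcoe : ({e | e ∈ E' ∧ x ∈ N' e} : Set (V × V)) =
            ((E'.filter fun e => x ∈ N' e : Finset (V × V)) : Set (V × V)) := by
          rw [Finset.coe_filter]
        rw [hcoe, Set.ncard_coe_finset]
        have hpos : 0 ≤ s (i + 1) * n := mul_nonneg (hs0 _).le hn0'.le
        by_cases hx : (E'.filter fun e => x ∈ N' e) = ∅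
        · rw [hx]
          simpa using hpos
        obtain ⟨e₀, he₀⟩ := Finset.nonempty_iff_ne_empty.mpr hx
        obtain ⟨he₀, hxe₀⟩ := Finset.mem_filter.mp he₀
        obtain ⟨hxS', hnear₀⟩ := (hN' e₀ x).mp hxe₀
        have hxS : x ∉ S := fun h' => hxS' (hSS' h')
        refine (hE.mono ((Finset.filter_subset _ _).trans hE'E)).card_le_of_notMem_hubs
          (H := H) (S := S) (F := F) (z := x) (fun e he => hE'F e (Finset.mem_filter.mp he).1)
          (fun e he => ((hN' e x).mp (Finset.mem_filter.mp he).2).2) hxS (fun hxhub => ?_)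
        -- A hub at scale `i + 1` outside `S'` is not a hub at scale `i`, because those lie in `S'`;
        -- but no edge of `E'` is near such an intermediate hub.
        refine (hE' e₀ he₀).2.2 x hxhub (fun hxi => hxS' ?_) hnear₀
        exact Finset.mem_union_right _ (hubs_anti hh2 hxi))
    have hE'n : n ≤ 4 * E'.card := by
      have h1 : (Y.card : ℝ) ≤ (4 * E'.card : ℕ) := Nat.cast_le.mpr (by omega)
      rwa [Nat.cast_mul] at h1
    -- From `n ≤ 4 * E'.card ≤ 4 * b * s (i + 1) * n * D.card`, cancel `n` and use the choice of `s
    -- (i + 1)`.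
    have hDm : R (s i) + q (s i) + k ≤ D.card := by
      by_contra hlt
      have hlt' : (D.card : ℝ) + 1 ≤ (R (s i) + q (s i) + k : ℕ) := by exact_mod_cast not_le.mp hlt
      have h1 := hm _ hi
      rw [← hs_succ] at h1
      have hb' : (0 : ℝ) < b := by exact_mod_cast hb
      have hpos : 0 < 4 * b * s (i + 1) := by have := hs0 (i + 1); positivity
      have h2 : 4 * b * s (i + 1) * ((D.card : ℝ) + 1) ≤ 1 :=
        (mul_le_mul_of_nonneg_left hlt' hpos.le).trans h1
      have h3 : 4 * b * s (i + 1) * (D.card : ℝ) < 1 := by linarith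
      have h4 : n * (4 * b * s (i + 1) * (D.card : ℝ)) < n * 1 := mul_lt_mul_of_pos_left h3 hn0'
      nlinarith
    refine exists_isMatchingGadget_of_pairwiseDisjoint (hη'0 _ hi) hμ' hμ'1 hprot hY' (hq _ hi)
      (E := D) (fun e he => ?_) (fun e he f hf v hv hve hvf => ?_) (by omega)
    · have heE' := hDE he
      refine ⟨(hE'S e heE').1, (hE'S e heE').2, hF _ _ (hE'F e heE'), ?_⟩
      exact (codegree_anti hSS' _ _).trans (Nat.lt_succ_iff.mp (hE'F e heE').2.2.2)
    · by_contra hne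
      exact Finset.disjoint_left.mp (hD he hf hne) ((hN' e v).mpr ⟨hv, hve⟩)
        ((hN' f v).mpr ⟨hv, hvf⟩)

theorem exists_gadgetBound {b : ℕ} (hb : 0 < b) (k t : ℕ) :
    ∀ η > 0, ∃ N, GadgetBound.{u} b k t η N := by
  induction t with
  | zero => exact fun η _ => ⟨1, gadgetBound_zero b k η⟩
  | succ t ih => exact fun η hη => exists_gadgetBound_succ hb ih hη

end Main

theorem mainTheorem4 (𝓗 : Set FiniteGraph.{u})
    (hvc : ¬ IsBoundedOn (fun H => H.graph.vertexCoverNum) 𝓗)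
    (htw : IsBoundedOn (fun H => treewidth H.graph) 𝓗) (k : ℕ) :
    ∃ H ∈ 𝓗, ∃ M : Set H.V, IsMatchingGadget H.graph k M := by
  classical
  obtain ⟨w, hw⟩ := htw
  obtain ⟨N, hN⟩ := exists_gadgetBound.{u} (Nat.succ_pos w) k (3 * (w + 1) + 1) 1 one_pos
  simp only [IsBoundedOn, not_exists, not_forall] at hvc
  obtain ⟨H, hH, hHvc⟩ := hvc (2 * N)
  refine ⟨H, hH, ?_⟩
  have := Fintype.ofFinite H.V
  have htops := hasSmallTops_of_treewidth_le (hw H hH)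
  -- The empty set is trivially protected, so zero weight suffices. A cover of the low edges with
  -- fewer than `N` vertices would give a vertex cover of size at most `2 * N`.
  refine hN H.V H.graph ∅ (fun _ => 0) htops (by simp) (by simp) (by simp)
    (fun M _ _ D φ _ x hx => absurd hx (Finset.notMem_empty x)) fun Y hY => ?_
  by_contra hlt
  obtain ⟨X, hX, hXcard⟩ := htops.exists_covers_adj (Nat.succ_pos w) hY
  apply hHvc
  have hcover : H.graph.IsVertexCover (X : Set H.V) := fun u v huv => hX u v huv
  refine hcover.vertexCoverNum_le.trans ?_
  rw [Set.encard_coe_eq_coe_finsetCard]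
  exact_mod_cast (by omega : X.card ≤ 2 * N)
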